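/- **Theorem 1 (Soundness).** *The source logic iHOL* is intuitionistic monadic higher-order logic: sorts $s ::= * \mid \mathcal P(s)$; terms $t ::= u \mid \{u:s\mid\psi\} \mid \{\psi\}$ of sorts $s$, $\mathcal P(s)$, $*$; propositions $\psi ::= \langle t\rangle \mid t\in t \mid \psi\supset\psi \mid \forall u{:}s.\,\psi$, where $\langle t\rangle$ is base membership for $t:*$. Sequents $\mathbb S\vdash\Psi\Rrightarrow\psi$ are derived by the identity rule, introduction and elimination for $\supset$ and $\forall$, and the rules identifying $t\in\{u:s\mid\psi\}$ with $\psi[u:=t]$ and $\langle\{\psi\}\rangle$ with $\psi$. *The target logic EffHOL* has kinds $\kappa ::= \star\mid\mathrm{con}(\kappa)$ (type constructors with an argument of kind $\kappa$); types $\tau ::= X\mid\tau\,\tau\mid\lambda X{:}\kappa.\tau\mid\tau\to\tau\mid\prod_{X:\kappa}\tau\mid M\tau$; programs $p ::= x\mid\Lambda X{:}\kappa.p\mid\lambda x{:}\tau.p\mid p\,\tau\mid p\,p\mid\mathrm{ret}\,p\mid\mathrm{bind}\;x\leftarrow p;\,p$; indices $\sigma ::= \mathrm{ref}(\tau)\mid\mathrm{ref}(\tau,\sigma)\mid\prod_{X:\kappa}\sigma$;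 expressions $e ::= y\mid\{x:\tau,y:\sigma\mid\varphi\}\mid\{x:\tau\mid\varphi\}\mid\Lambda X{:}\kappa.e\mid e\,\tau$; and specifications $\varphi$ built from memberships $p\in e$ and $p\in e(e')$, implication, the modality $[x\leftarrow p]\varphi$ ("after running $p$, $\varphi$ holds of its result $x$"), and universal quantification over types, programs and expressions. Judgments are made in kind, index and type contexts $\mathbb K\mid\mathbb I\mid\mathbb T$. Typing is that of a System-$F_\omega$-style calculus with monadic return and bind, closed under conversion $\equiv$ (the congruence generated by $\beta$ for type abstractions in types and in expressions). Sequents $\mathbb K\mid\mathbb I\mid\mathbb T\vdash\Phi\Rightarrow\varphi$, all well typed, are derived by identity, introduction and elimination for implication, the three quantifiers and both comprehensions, the modal rules $$\frac{\Phi\Rightarrow\varphi[x:=p]}{\Phi\Rightarrow[x\leftarrow\mathrm{ret}\,p]\varphi}\qquad\frac{\Phi\Rightarrow[x_1\leftarrow p_1][x_2\leftarrow p_2]\varphi}{\Phi\Rightarrow[x_2\leftarrow(\mathrm{bind}\;x_1\leftarrow p_1;p_2)]\varphi}\ (x_1\notin\varphi)\qquad\frac{\Phi,\varphi_1\Rightarrow\varphi_2\quad\Phi\Rightarrow[x\leftarrow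 p]\varphi_1}{\Phi\Rightarrow[x\leftarrow p]\varphi_2}\ (x\notin\Phi),$$ closure under $\equiv$, and closure under anti-reduction (from $\varphi[x:=p_2]$ infer $\varphi[x:=p_1]$ when $p_1\rightsquigarrow p_2$), where $\rightsquigarrow$ is one-step $\beta$-reduction: $\mathrm{bind}\;x\leftarrow\mathrm{ret}\,p_1;p_2\rightsquigarrow p_2[x:=p_1]$, $(\Lambda X{:}\kappa.p)\tau\rightsquigarrow p[X:=\tau]$, and $(\lambda x{:}\tau.p)V\rightsquigarrow p[x:=V]$ for $V$ a variable or an abstraction. The Hoare triple $\{\Phi\}\,x\leftarrow p\,\{\varphi\}$ is the sequent $\Phi\Rightarrow[x\leftarrow p]\varphi$. *The realizability translation* (writing $|{-}|$ for the translation to kinds or types, $\widehat t$ for the translation of terms to expressions): - sorts: $|{*}|=\star$, $|\mathcal P(s)|=\mathrm{con}(|s|)$; $[\![*]\!]_\tau=\mathrm{ref}(\tau)$, $[\![\mathcal P(s)]\!]_\tau=\prod_{X:|s|}\mathrm{ref}(\tau X,[\![s]\!]_X)$; - terms: $|u|=X_u$, $|\{u:s\mid\psi\}|=\lambda X_u{:}|s|.\,[\![\psi]\!]$,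 $|\{\psi\}|=[\![\psi]\!]$; $\widehat u=y_u$, $\widehat{\{u:s\mid\psi\}}=\Lambda X_u{:}|s|.\{x:[\![\psi]\!],\,y_u:[\![s]\!]_{X_u}\mid[\![\psi]\!]_x\}$, $\widehat{\{\psi\}}=\{x:[\![\psi]\!]\mid[\![\psi]\!]_x\}$; - propositions to types: $[\![\psi_1\supset\psi_2]\!]=[\![\psi_1]\!]\to M[\![\psi_2]\!]$, $[\![\forall u{:}s.\psi]\!]=\prod_{X_u:|s|}M[\![\psi]\!]$, $[\![t_1\in t_2]\!]=|t_2|\,|t_1|$, $[\![\langle t\rangle]\!]=|t|$; - propositions to specifications ("$p$ realizes $\psi$"): $[\![\psi_1\supset\psi_2]\!]_p=\forall x_1{:}[\![\psi_1]\!].\,[\![\psi_1]\!]_{x_1}\supset[x_2\leftarrow p\,x_1][\![\psi_2]\!]_{x_2}$, $[\![\forall u{:}s.\psi]\!]_p=\forall X_u{:}|s|.\,\forall y_u{:}[\![s]\!]_{X_u}.\,[x_0\leftarrow p\,X_u][\![\psi]\!]_{x_0}$, $[\![t_1\in t_2]\!]_p=\big(p\in(\widehat{t_2}\,|t_1|)(\widehat{t_1})\big)$,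 $[\![\langle t\rangle]\!]_p=(p\in\widehat t\,)$. For $\mathbb S=u_1:s_1,\dots,u_m:s_m$ let $|\mathbb S|$ be the kind context $X_{u_i}:|s_i|$ and $[\![\mathbb S]\!]$ the index context $y_{u_i}:[\![s_i]\!]_{X_{u_i}}$; for $\Psi=\psi_1,\dots,\psi_n$ let $|\Psi|$ be the type context $x_i:[\![\psi_i]\!]$ and $[\![\Psi]\!]$ the list of specifications $[\![\psi_i]\!]_{x_i}$. *Claim.* For every derivation of an iHOL sequent $\mathbb S\vdash\psi_1,\dots,\psi_n\Rrightarrow\psi$ there is an EffHOL program $p$ with $$|\mathbb S|\mid|\Psi|\vdash p:M[\![\psi]\!]$$ such that for all further contexts $\mathbb K,\mathbb I,\mathbb T$ and every finite collection $\Phi$ of specifications, well formed over the contexts extended with $\mathbb K,\mathbb I,\mathbb T$, the Hoare triple $$|\mathbb S|,\mathbb K\;\mid\;[\![\mathbb S]\!],\mathbb I\;\mid\;|\Psi|,\mathbb T\;\vdash\;\{[\![\Psi]\!],\Phi\}\;x_r\leftarrow p\;\{[\![\psi]\!]_{x_r}\}$$ is derivable in EffHOL. The program $p$ is built constructively, by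 structural recursion on the derivation; it is fixed before $\mathbb K,\mathbb I,\mathbb T,\Phi$, and it involves the monad only through the abstract constructs $\mathrm{ret}$ and $\mathrm{bind}$, so it does not depend on a choice of monad. Explicitly, a use of the hypothesis $\psi_i$ gives $\mathrm{ret}\,x_i$; $\supset$-introduction $\mathrm{ret}(\lambda x{:}[\![\psi_1]\!].p_0)$; $\supset$-elimination $\mathrm{bind}\;x_0\leftarrow p_0;\,\mathrm{bind}\;x_1\leftarrow p_1;\,x_0x_1$; $\forall$-introduction $\mathrm{ret}(\Lambda X_u{:}|s|.p_0)$; $\forall$-elimination at $t$ $\mathrm{bind}\;x_0\leftarrow p_0;\,x_0|t|$; and the membership rules keep the program of their premise. -/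

import Mathlib

/-!
Both calculi are presented with de Bruijn indices: a variable is a natural number that counts
binders (and then context entries) outwards, so contexts are lists whose head is the entry
declared last, and the comma `Γ, a` of named presentations is `a :: Γ`. Expressions up to renaming
of bound variables are thus plain syntax trees, and freshness conditions become shifts by one.
-/

/-- Prepend a value to a sequence: `0 ↦ a` and `n + 1 ↦ f n`. -/
def scons {α : Type} (a : α) (f : ℕ → α) : ℕ → α
  | 0 => a
  | n + 1 => f n

/-- The lifting of a renaming of variables under one binder. -/
def liftRen (ξ : ℕ → ℕ) : ℕ → ℕ :=
  scons 0 (fun n => ξ n + 1)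

/-! ### Intuitionistic higher-order logic -/

namespace HOL

/-- Sorts: the base sort of propositions, and predicates on a sort. -/
inductive Srt : Type
  | star : Srt
  | pred (s : Srt) : Srt

mutual
/-- Terms: variables, comprehension `{u : s | ψ}` (binding `u`), base comprehension `{ψ}`. -/
inductive Term : Type
  | var (i : ℕ) : Term
  | compr (s : Srt) (ψ : Form) : Term
  | comprBase (ψ : Form) : Term
/-- Propositions: base membership of `t`, membership `t₁ ∈ t₂`, implication, `∀ u : s, ψ`. -/
inductive Form : Type
  | memBase (t : Term) : Form
  | mem (t₁ t₂ : Term) : Form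
  | imp (ψ₁ ψ₂ : Form) : Form
  | all (s : Srt) (ψ : Form) : Form
end

mutual
/-- Renaming of the free variables of a term. -/
def Term.ren : Term → (ℕ → ℕ) → Term
  | .var i, ξ => .var (ξ i)
  | .compr s ψ, ξ => .compr s (ψ.ren (liftRen ξ))
  | .comprBase ψ, ξ => .comprBase (ψ.ren ξ)
/-- Renaming of the free variables of a proposition. -/
def Form.ren : Form → (ℕ → ℕ) → Form
  | .memBase t, ξ => .memBase (t.ren ξ)
  | .mem t₁ t₂, ξ => .mem (t₁.ren ξ) (t₂.ren ξ)
  | .imp ψ₁ ψ₂, ξ => .imp (ψ₁.ren ξ) (ψ₂.ren ξ)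
  | .all s ψ, ξ => .all s (ψ.ren (liftRen ξ))
end

/-- The lifting of a substitution under one binder. -/
def liftSub (θ : ℕ → Term) : ℕ → Term :=
  scons (.var 0) (fun n => (θ n).ren Nat.succ)

mutual
/-- Simultaneous capture-avoiding substitution in a term. -/
def Term.subst : Term → (ℕ → Term) → Term
  | .var i, θ => θ i
  | .compr s ψ, θ => .compr s (ψ.subst (liftSub θ))
  | .comprBase ψ, θ => .comprBase (ψ.subst θ)
/-- Simultaneous capture-avoiding substitution in a proposition. -/
def Form.subst : Form → (ℕ → Term) → Form
  | .memBase t, θ => .memBase (t.subst θ)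
  | .mem t₁ t₂, θ => .mem (t₁.subst θ) (t₂.subst θ)
  | .imp ψ₁ ψ₂, θ => .imp (ψ₁.subst θ) (ψ₂.subst θ)
  | .all s ψ, θ => .all s (ψ.subst (liftSub θ))
end

/-- `ψ[u := t]` for the variable `u` bound last. -/
def Form.inst (ψ : Form) (t : Term) : Form :=
  ψ.subst (scons t Term.var)

mutual
/-- The sorting judgment `S ⊢ t : s`. -/
inductive HasSort : List Srt → Term → Srt → Prop
  | var {S : List Srt} {i : ℕ} {s : Srt} : S[i]? = some s → HasSort S (.var i) s
  | compr {S : List Srt} {s : Srt} {ψ : Form} :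
      IsForm (s :: S) ψ → HasSort S (.compr s ψ) (.pred s)
  | comprBase {S : List Srt} {ψ : Form} : IsForm S ψ → HasSort S (.comprBase ψ) .star
/-- The judgment `S ⊢ ψ` that a proposition is well formed. -/
inductive IsForm : List Srt → Form → Prop
  | memBase {S : List Srt} {t : Term} : HasSort S t .star → IsForm S (.memBase t)
  | mem {S : List Srt} {s : Srt} {t₁ t₂ : Term} :
      HasSort S t₁ s → HasSort S t₂ (.pred s) → IsForm S (.mem t₁ t₂)
  | imp {S : List Srt} {ψ₁ ψ₂ : Form} :
      IsForm S ψ₁ → IsForm S ψ₂ → IsForm S (.imp ψ₁ ψ₂)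
  | all {S : List Srt} {s : Srt} {ψ : Form} : IsForm (s :: S) ψ → IsForm S (.all s ψ)
end

/-- Derivations of the sequent `S ⊢ Ψ ⇛ ψ`. They are data, so that programs can be extracted from
them; the sequent is derivable when this type is inhabited. Only well-formed sequents have a
derivation. -/
inductive Derivation : List Srt → List Form → Form → Type
  | ax {S : List Srt} {Ψ : List Form} {ψ : Form} (i : ℕ) :
      (∀ χ ∈ Ψ, IsForm S χ) → Ψ[i]? = some ψ → Derivation S Ψ ψ
  | impI {S : List Srt} {Ψ : List Form} {ψ₁ ψ₂ : Form} :
      Derivation S (ψ₁ :: Ψ) ψ₂ → Derivation S Ψ (.imp ψ₁ ψ₂)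
  | impE {S : List Srt} {Ψ : List Form} {ψ₁ ψ₂ : Form} :
      Derivation S Ψ (.imp ψ₁ ψ₂) → Derivation S Ψ ψ₁ → Derivation S Ψ ψ₂
  | uniI {S : List Srt} {Ψ : List Form} {s : Srt} {ψ : Form} :
      Derivation (s :: S) (Ψ.map (fun χ => χ.ren Nat.succ)) ψ → Derivation S Ψ (.all s ψ)
  | uniE {S : List Srt} {Ψ : List Form} {s : Srt} {ψ : Form} (t : Term) :
      Derivation S Ψ (.all s ψ) → HasSort S t s → Derivation S Ψ (ψ.inst t)
  | memI {S : List Srt} {Ψ : List Form} {s : Srt} {ψ : Form} {t : Term} :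
      Derivation S Ψ (ψ.inst t) → HasSort S t s → IsForm (s :: S) ψ →
      Derivation S Ψ (.mem t (.compr s ψ))
  | memE {S : List Srt} {Ψ : List Form} {s : Srt} {ψ : Form} {t : Term} :
      Derivation S Ψ (.mem t (.compr s ψ)) → Derivation S Ψ (ψ.inst t)
  | memBaseI {S : List Srt} {Ψ : List Form} {ψ : Form} :
      Derivation S Ψ ψ → Derivation S Ψ (.memBase (.comprBase ψ))
  | memBaseE {S : List Srt} {Ψ : List Form} {ψ : Form} :
      Derivation S Ψ (.memBase (.comprBase ψ)) → Derivation S Ψ ψ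

end HOL

/-! ### Effectful higher-order logic -/

namespace EffHOL

/-- Kinds: the base kind, and type constructors taking an argument of kind `κ` to a type. -/
inductive Kind : Type
  | star : Kind
  | con (κ : Kind) : Kind

/-- Types: variables, application, abstraction, functions, universal types, and the type
`comp τ` (written `M τ`) of computations of type `τ`. -/
inductive Ty : Type
  | var (i : ℕ) : Ty
  | app (τ₂ τ₁ : Ty) : Ty
  | lam (κ : Kind) (τ : Ty) : Ty
  | arr (τ₁ τ₂ : Ty) : Ty
  | all (κ : Kind) (τ : Ty) : Ty
  | comp (τ : Ty) : Ty

/-- Programs. Type variables and program variables are counted separately; `bind p₁ p₂` binds a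
program variable in `p₂`. -/
inductive Prog : Type
  | var (i : ℕ) : Prog
  | tlam (κ : Kind) (p : Prog) : Prog
  | lam (τ : Ty) (p : Prog) : Prog
  | tapp (p : Prog) (τ : Ty) : Prog
  | app (p₂ p₁ : Prog) : Prog
  | ret (p : Prog) : Prog
  | bind (p₁ p₂ : Prog) : Prog

/-- Indices: base refinements, refinements, and universal indices. -/
inductive Index : Type
  | refBase (τ : Ty) : Index
  | ref (τ : Ty) (σ : Index) : Index
  | all (κ : Kind) (σ : Index) : Index

mutual
/-- Expressions. Type, program and expression variables are counted separately. In `compr τ σ φ`,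
i.e. `{x : τ, y : σ | φ}`, a program variable and an expression variable are bound in `φ`; in
`comprBase τ φ`, i.e. `{x : τ | φ}`, a program variable. -/
inductive Expr : Type
  | var (i : ℕ) : Expr
  | compr (τ : Ty) (σ : Index) (φ : Spec) : Expr
  | comprBase (τ : Ty) (φ : Spec) : Expr
  | tlam (κ : Kind) (e : Expr) : Expr
  | tapp (e : Expr) (τ : Ty) : Expr
/-- Specifications. `mem p e₂ e₁` says that the predicate `e₂` with argument `e₁` holds of `p`;
`after p φ` is the modality "`φ` holds of the result `x` of running `p`", binding `x` in `φ`. -/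
inductive Spec : Type
  | mem (p : Prog) (e₂ e₁ : Expr) : Spec
  | memBase (p : Prog) (e : Expr) : Spec
  | imp (φ₁ φ₂ : Spec) : Spec
  | after (p : Prog) (φ : Spec) : Spec
  | allTy (κ : Kind) (φ : Spec) : Spec
  | allProg (τ : Ty) (φ : Spec) : Spec
  | allExpr (σ : Index) (φ : Spec) : Spec
end

/-! #### Renaming

The arguments `ξ`, `ζ`, `η` rename type, program and expression variables respectively. -/

/-- Renaming of type variables in a type. -/
def Ty.ren : Ty → (ℕ → ℕ) → Ty
  | .var i, ξ => .var (ξ i)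
  | .app τ₂ τ₁, ξ => .app (τ₂.ren ξ) (τ₁.ren ξ)
  | .lam κ τ, ξ => .lam κ (τ.ren (liftRen ξ))
  | .arr τ₁ τ₂, ξ => .arr (τ₁.ren ξ) (τ₂.ren ξ)
  | .all κ τ, ξ => .all κ (τ.ren (liftRen ξ))
  | .comp τ, ξ => .comp (τ.ren ξ)

/-- Renaming of type and program variables in a program. -/
def Prog.ren : Prog → (ℕ → ℕ) → (ℕ → ℕ) → Prog
  | .var i, _, ζ => .var (ζ i)
  | .tlam κ p, ξ, ζ => .tlam κ (p.ren (liftRen ξ) ζ)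
  | .lam τ p, ξ, ζ => .lam (τ.ren ξ) (p.ren ξ (liftRen ζ))
  | .tapp p τ, ξ, ζ => .tapp (p.ren ξ ζ) (τ.ren ξ)
  | .app p₂ p₁, ξ, ζ => .app (p₂.ren ξ ζ) (p₁.ren ξ ζ)
  | .ret p, ξ, ζ => .ret (p.ren ξ ζ)
  | .bind p₁ p₂, ξ, ζ => .bind (p₁.ren ξ ζ) (p₂.ren ξ (liftRen ζ))

/-- Renaming of type variables in an index. -/
def Index.ren : Index → (ℕ → ℕ) → Index
  | .refBase τ, ξ => .refBase (τ.ren ξ)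
  | .ref τ σ, ξ => .ref (τ.ren ξ) (σ.ren ξ)
  | .all κ σ, ξ => .all κ (σ.ren (liftRen ξ))

mutual
/-- Renaming of type, program and expression variables in an expression. -/
def Expr.ren : Expr → (ℕ → ℕ) → (ℕ → ℕ) → (ℕ → ℕ) → Expr
  | .var i, _, _, η => .var (η i)
  | .compr τ σ φ, ξ, ζ, η =>
      .compr (τ.ren ξ) (σ.ren ξ) (φ.ren ξ (liftRen ζ) (liftRen η))
  | .comprBase τ φ, ξ, ζ, η => .comprBase (τ.ren ξ) (φ.ren ξ (liftRen ζ) η)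
  | .tlam κ e, ξ, ζ, η => .tlam κ (e.ren (liftRen ξ) ζ η)
  | .tapp e τ, ξ, ζ, η => .tapp (e.ren ξ ζ η) (τ.ren ξ)
/-- Renaming of type, program and expression variables in a specification. -/
def Spec.ren : Spec → (ℕ → ℕ) → (ℕ → ℕ) → (ℕ → ℕ) → Spec
  | .mem p e₂ e₁, ξ, ζ, η => .mem (p.ren ξ ζ) (e₂.ren ξ ζ η) (e₁.ren ξ ζ η)
  | .memBase p e, ξ, ζ, η => .memBase (p.ren ξ ζ) (e.ren ξ ζ η)
  | .imp φ₁ φ₂, ξ, ζ, η => .imp (φ₁.ren ξ ζ η) (φ₂.ren ξ ζ η)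
  | .after p φ, ξ, ζ, η => .after (p.ren ξ ζ) (φ.ren ξ (liftRen ζ) η)
  | .allTy κ φ, ξ, ζ, η => .allTy κ (φ.ren (liftRen ξ) ζ η)
  | .allProg τ φ, ξ, ζ, η => .allProg (τ.ren ξ) (φ.ren ξ (liftRen ζ) η)
  | .allExpr σ φ, ξ, ζ, η => .allExpr (σ.ren ξ) (φ.ren ξ ζ (liftRen η))
end

/-! #### Simultaneous capture-avoiding substitution

The arguments `α`, `β`, `γ` are substituted for type, program and expression variables
respectively. -/

/-- The lifting of a type substitution under a binder of a type variable. -/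
def liftTy (α : ℕ → Ty) : ℕ → Ty :=
  scons (.var 0) (fun n => (α n).ren Nat.succ)

/-- The lifting of a program substitution under a binder of a program variable. -/
def liftProg (β : ℕ → Prog) : ℕ → Prog :=
  scons (.var 0) (fun n => (β n).ren id Nat.succ)

/-- The lifting of an expression substitution under a binder of an expression variable. -/
def liftExpr (γ : ℕ → Expr) : ℕ → Expr :=
  scons (.var 0) (fun n => (γ n).ren id id Nat.succ)

/-- Substitution in a type. -/
def Ty.subst : Ty → (ℕ → Ty) → Ty
  | .var i, α => α i
  | .app τ₂ τ₁, α => .app (τ₂.subst α) (τ₁.subst α)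
  | .lam κ τ, α => .lam κ (τ.subst (liftTy α))
  | .arr τ₁ τ₂, α => .arr (τ₁.subst α) (τ₂.subst α)
  | .all κ τ, α => .all κ (τ.subst (liftTy α))
  | .comp τ, α => .comp (τ.subst α)

/-- Substitution in a program. -/
def Prog.subst : Prog → (ℕ → Ty) → (ℕ → Prog) → Prog
  | .var i, _, β => β i
  | .tlam κ p, α, β => .tlam κ (p.subst (liftTy α) (fun n => (β n).ren Nat.succ id))
  | .lam τ p, α, β => .lam (τ.subst α) (p.subst α (liftProg β))
  | .tapp p τ, α, β => .tapp (p.subst α β) (τ.subst α)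
  | .app p₂ p₁, α, β => .app (p₂.subst α β) (p₁.subst α β)
  | .ret p, α, β => .ret (p.subst α β)
  | .bind p₁ p₂, α, β => .bind (p₁.subst α β) (p₂.subst α (liftProg β))

/-- Substitution in an index. -/
def Index.subst : Index → (ℕ → Ty) → Index
  | .refBase τ, α => .refBase (τ.subst α)
  | .ref τ σ, α => .ref (τ.subst α) (σ.subst α)
  | .all κ σ, α => .all κ (σ.subst (liftTy α))

mutual
/-- Substitution in an expression. -/
def Expr.subst : Expr → (ℕ → Ty) → (ℕ → Prog) → (ℕ → Expr) → Expr
  | .var i, _, _, γ => γ i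
  | .compr τ σ φ, α, β, γ =>
      .compr (τ.subst α) (σ.subst α)
        (φ.subst α (liftProg β) (liftExpr (fun n => (γ n).ren id Nat.succ id)))
  | .comprBase τ φ, α, β, γ =>
      .comprBase (τ.subst α) (φ.subst α (liftProg β) (fun n => (γ n).ren id Nat.succ id))
  | .tlam κ e, α, β, γ =>
      .tlam κ (e.subst (liftTy α) (fun n => (β n).ren Nat.succ id)
        (fun n => (γ n).ren Nat.succ id id))
  | .tapp e τ, α, β, γ => .tapp (e.subst α β γ) (τ.subst α)
/-- Substitution in a specification. -/
def Spec.subst : Spec → (ℕ → Ty) → (ℕ → Prog) → (ℕ → Expr) → Spec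
  | .mem p e₂ e₁, α, β, γ => .mem (p.subst α β) (e₂.subst α β γ) (e₁.subst α β γ)
  | .memBase p e, α, β, γ => .memBase (p.subst α β) (e.subst α β γ)
  | .imp φ₁ φ₂, α, β, γ => .imp (φ₁.subst α β γ) (φ₂.subst α β γ)
  | .after p φ, α, β, γ =>
      .after (p.subst α β) (φ.subst α (liftProg β) (fun n => (γ n).ren id Nat.succ id))
  | .allTy κ φ, α, β, γ =>
      .allTy κ (φ.subst (liftTy α) (fun n => (β n).ren Nat.succ id)
        (fun n => (γ n).ren Nat.succ id id))
  | .allProg τ φ, α, β, γ =>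
      .allProg (τ.subst α) (φ.subst α (liftProg β) (fun n => (γ n).ren id Nat.succ id))
  | .allExpr σ φ, α, β, γ => .allExpr (σ.subst α) (φ.subst α β (liftExpr γ))
end

/-- `τ[X := τ']` for the type variable bound last. -/
def Ty.inst (τ τ' : Ty) : Ty := τ.subst (scons τ' Ty.var)

/-- `σ[X := τ]`. -/
def Index.inst (σ : Index) (τ : Ty) : Index := σ.subst (scons τ Ty.var)

/-- `p[X := τ]`. -/
def Prog.instTy (p : Prog) (τ : Ty) : Prog := p.subst (scons τ Ty.var) Prog.var

/-- `p[x := q]`. -/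
def Prog.inst (p q : Prog) : Prog := p.subst Ty.var (scons q Prog.var)

/-- `e[X := τ]`. -/
def Expr.instTy (e : Expr) (τ : Ty) : Expr := e.subst (scons τ Ty.var) Prog.var Expr.var

/-- `φ[X := τ]`. -/
def Spec.instTy (φ : Spec) (τ : Ty) : Spec := φ.subst (scons τ Ty.var) Prog.var Expr.var

/-- `φ[x := p]`. -/
def Spec.instProg (φ : Spec) (p : Prog) : Spec := φ.subst Ty.var (scons p Prog.var) Expr.var

/-- `φ[y := e]`. -/
def Spec.instExpr (φ : Spec) (e : Expr) : Spec := φ.subst Ty.var Prog.var (scons e Expr.var)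

/-! #### Reduction and conversion -/

/-- The values to which a function may be applied in a reduction step. -/
inductive Prog.IsValue : Prog → Prop
  | var (i : ℕ) : Prog.IsValue (.var i)
  | tlam (κ : Kind) (p : Prog) : Prog.IsValue (.tlam κ p)
  | lam (τ : Ty) (p : Prog) : Prog.IsValue (.lam τ p)

/-- One-step reduction `p ⇝ p'` of programs. -/
inductive Prog.Red : Prog → Prog → Prop
  | bindRet (p₁ p₂ : Prog) : Prog.Red (.bind (.ret p₁) p₂) (p₂.inst p₁)
  | tbeta (κ : Kind) (p : Prog) (τ : Ty) : Prog.Red (.tapp (.tlam κ p) τ) (p.instTy τ)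
  | beta (τ : Ty) (p v : Prog) : v.IsValue → Prog.Red (.app (.lam τ p) v) (p.inst v)

/-- Conversion of types: the congruence generated by `(λ X : κ, τ₁) τ₂ ≡ τ₁[X := τ₂]`. -/
inductive Ty.Conv : Ty → Ty → Prop
  | beta (κ : Kind) (τ₁ τ₂ : Ty) : Ty.Conv (.app (.lam κ τ₁) τ₂) (τ₁.inst τ₂)
  | comp {τ τ' : Ty} : Ty.Conv τ τ' → Ty.Conv (.comp τ) (.comp τ')
  | symm {τ τ' : Ty} : Ty.Conv τ τ' → Ty.Conv τ' τ
  | trans {τ τ' τ'' : Ty} : Ty.Conv τ τ' → Ty.Conv τ' τ'' → Ty.Conv τ τ''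
  | app {τ₂ τ₂' τ₁ τ₁' : Ty} :
      Ty.Conv τ₂ τ₂' → Ty.Conv τ₁ τ₁' → Ty.Conv (.app τ₂ τ₁) (.app τ₂' τ₁')
  | lam {κ : Kind} {τ τ' : Ty} : Ty.Conv τ τ' → Ty.Conv (.lam κ τ) (.lam κ τ')
  | arr {τ₁ τ₁' τ₂ τ₂' : Ty} :
      Ty.Conv τ₁ τ₁' → Ty.Conv τ₂ τ₂' → Ty.Conv (.arr τ₁ τ₂) (.arr τ₁' τ₂')
  | all {κ : Kind} {τ τ' : Ty} : Ty.Conv τ τ' → Ty.Conv (.all κ τ) (.all κ τ')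
  | refl (τ : Ty) : Ty.Conv τ τ

/-- Conversion of programs: conversion of the types that occur in them. -/
inductive Prog.Conv : Prog → Prog → Prop
  | symm {p p' : Prog} : Prog.Conv p p' → Prog.Conv p' p
  | trans {p p' p'' : Prog} : Prog.Conv p p' → Prog.Conv p' p'' → Prog.Conv p p''
  | tlam {κ : Kind} {p p' : Prog} : Prog.Conv p p' → Prog.Conv (.tlam κ p) (.tlam κ p')
  | lam {τ τ' : Ty} {p p' : Prog} :
      Ty.Conv τ τ' → Prog.Conv p p' → Prog.Conv (.lam τ p) (.lam τ' p')
  | tapp {p p' : Prog} {τ τ' : Ty} :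
      Prog.Conv p p' → Ty.Conv τ τ' → Prog.Conv (.tapp p τ) (.tapp p' τ')
  | app {p₂ p₂' p₁ p₁' : Prog} :
      Prog.Conv p₂ p₂' → Prog.Conv p₁ p₁' → Prog.Conv (.app p₂ p₁) (.app p₂' p₁')
  | ret {p p' : Prog} : Prog.Conv p p' → Prog.Conv (.ret p) (.ret p')
  | bind {p₁ p₁' p₂ p₂' : Prog} :
      Prog.Conv p₁ p₁' → Prog.Conv p₂ p₂' → Prog.Conv (.bind p₁ p₂) (.bind p₁' p₂')
  | refl (p : Prog) : Prog.Conv p p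

/-- Conversion of indices: conversion of the types that occur in them. -/
inductive Index.Conv : Index → Index → Prop
  | symm {σ σ' : Index} : Index.Conv σ σ' → Index.Conv σ' σ
  | trans {σ σ' σ'' : Index} : Index.Conv σ σ' → Index.Conv σ' σ'' → Index.Conv σ σ''
  | refBase {τ τ' : Ty} : Ty.Conv τ τ' → Index.Conv (.refBase τ) (.refBase τ')
  | ref {τ τ' : Ty} {σ σ' : Index} :
      Ty.Conv τ τ' → Index.Conv σ σ' → Index.Conv (.ref τ σ) (.ref τ' σ')
  | all {κ : Kind} {σ σ' : Index} : Index.Conv σ σ' → Index.Conv (.all κ σ) (.all κ σ')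
  | refl (σ : Index) : Index.Conv σ σ

mutual
/-- Conversion of expressions: the congruence generated by `(Λ X : κ, e) τ ≡ e[X := τ]` and by
the conversion of types. -/
inductive Expr.Conv : Expr → Expr → Prop
  | beta (κ : Kind) (e : Expr) (τ : Ty) : Expr.Conv (.tapp (.tlam κ e) τ) (e.instTy τ)
  | symm {e e' : Expr} : Expr.Conv e e' → Expr.Conv e' e
  | trans {e e' e'' : Expr} : Expr.Conv e e' → Expr.Conv e' e'' → Expr.Conv e e''
  | compr {τ τ' : Ty} {σ σ' : Index} {φ φ' : Spec} :
      Ty.Conv τ τ' → Index.Conv σ σ' → Spec.Conv φ φ' →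
      Expr.Conv (.compr τ σ φ) (.compr τ' σ' φ')
  | comprBase {τ τ' : Ty} {φ φ' : Spec} :
      Ty.Conv τ τ' → Spec.Conv φ φ' → Expr.Conv (.comprBase τ φ) (.comprBase τ' φ')
  | tlam {κ : Kind} {e e' : Expr} : Expr.Conv e e' → Expr.Conv (.tlam κ e) (.tlam κ e')
  | tapp {e e' : Expr} {τ τ' : Ty} :
      Expr.Conv e e' → Ty.Conv τ τ' → Expr.Conv (.tapp e τ) (.tapp e' τ')
  | refl (e : Expr) : Expr.Conv e e
/-- Conversion of specifications. -/
inductive Spec.Conv : Spec → Spec → Prop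
  | symm {φ φ' : Spec} : Spec.Conv φ φ' → Spec.Conv φ' φ
  | trans {φ φ' φ'' : Spec} : Spec.Conv φ φ' → Spec.Conv φ' φ'' → Spec.Conv φ φ''
  | mem {p p' : Prog} {e₂ e₂' e₁ e₁' : Expr} :
      Prog.Conv p p' → Expr.Conv e₂ e₂' → Expr.Conv e₁ e₁' →
      Spec.Conv (.mem p e₂ e₁) (.mem p' e₂' e₁')
  | memBase {p p' : Prog} {e e' : Expr} :
      Prog.Conv p p' → Expr.Conv e e' → Spec.Conv (.memBase p e) (.memBase p' e')
  | imp {φ₁ φ₁' φ₂ φ₂' : Spec} :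
      Spec.Conv φ₁ φ₁' → Spec.Conv φ₂ φ₂' → Spec.Conv (.imp φ₁ φ₂) (.imp φ₁' φ₂')
  | after {p p' : Prog} {φ φ' : Spec} :
      Prog.Conv p p' → Spec.Conv φ φ' → Spec.Conv (.after p φ) (.after p' φ')
  | allTy {κ : Kind} {φ φ' : Spec} : Spec.Conv φ φ' → Spec.Conv (.allTy κ φ) (.allTy κ φ')
  | allProg {τ τ' : Ty} {φ φ' : Spec} :
      Ty.Conv τ τ' → Spec.Conv φ φ' → Spec.Conv (.allProg τ φ) (.allProg τ' φ')
  | allExpr {σ σ' : Index} {φ φ' : Spec} :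
      Index.Conv σ σ' → Spec.Conv φ φ' → Spec.Conv (.allExpr σ φ) (.allExpr σ' φ')
  | refl (φ : Spec) : Spec.Conv φ φ
end

/-! #### Typing

`K`, `I`, `T` are kind, index and type contexts. Entries of `I` and `T` have type variables
declared in `K`, so they are shifted when `K` is extended. -/

/-- Shift of a type context under one more type variable. -/
def shiftTys (T : List Ty) : List Ty := T.map (fun τ => τ.ren Nat.succ)

/-- Shift of an index context under one more type variable. -/
def shiftIndices (I : List Index) : List Index := I.map (fun σ => σ.ren Nat.succ)

/-- The judgment `K ⊢ τ : κ`. -/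
inductive HasKind : List Kind → Ty → Kind → Prop
  | var {K : List Kind} {i : ℕ} {κ : Kind} : K[i]? = some κ → HasKind K (.var i) κ
  | app {K : List Kind} {τ₂ τ₁ : Ty} {κ : Kind} :
      HasKind K τ₁ κ → HasKind K τ₂ (.con κ) → HasKind K (.app τ₂ τ₁) .star
  | lam {K : List Kind} {κ : Kind} {τ : Ty} :
      HasKind (κ :: K) τ .star → HasKind K (.lam κ τ) (.con κ)
  | arr {K : List Kind} {τ₁ τ₂ : Ty} :
      HasKind K τ₁ .star → HasKind K τ₂ .star → HasKind K (.arr τ₁ τ₂) .star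
  | all {K : List Kind} {κ : Kind} {τ : Ty} :
      HasKind (κ :: K) τ .star → HasKind K (.all κ τ) .star
  | comp {K : List Kind} {τ : Ty} : HasKind K τ .star → HasKind K (.comp τ) .star

/-- The judgment that `σ` is a well-formed index in the kind context `K`. -/
inductive IsIndex : List Kind → Index → Prop
  | refBase {K : List Kind} {τ : Ty} : HasKind K τ .star → IsIndex K (.refBase τ)
  | ref {K : List Kind} {τ : Ty} {σ : Index} :
      HasKind K τ .star → IsIndex K σ → IsIndex K (.ref τ σ)
  | all {K : List Kind} {κ : Kind} {σ : Index} : IsIndex (κ :: K) σ → IsIndex K (.all κ σ)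

/-- The judgment `K | T ⊢ p : τ`. -/
inductive HasType : List Kind → List Ty → Prog → Ty → Prop
  | var {K : List Kind} {T : List Ty} {i : ℕ} {τ : Ty} :
      T[i]? = some τ → HasType K T (.var i) τ
  | tlam {K : List Kind} {T : List Ty} {κ : Kind} {p : Prog} {τ : Ty} :
      HasType (κ :: K) (shiftTys T) p τ → HasType K T (.tlam κ p) (.all κ τ)
  | lam {K : List Kind} {T : List Ty} {τ₁ τ₂ : Ty} {p : Prog} :
      HasKind K τ₁ .star → HasType K (τ₁ :: T) p τ₂ → HasType K T (.lam τ₁ p) (.arr τ₁ τ₂)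
  | tapp {K : List Kind} {T : List Ty} {κ : Kind} {p : Prog} {τ₁ τ₂ : Ty} :
      HasType K T p (.all κ τ₂) → HasKind K τ₁ κ → HasType K T (.tapp p τ₁) (τ₂.inst τ₁)
  | app {K : List Kind} {T : List Ty} {p₂ p₁ : Prog} {τ₁ τ₂ : Ty} :
      HasType K T p₂ (.arr τ₁ τ₂) → HasType K T p₁ τ₁ → HasType K T (.app p₂ p₁) τ₂
  | conv {K : List Kind} {T : List Ty} {p : Prog} {τ τ' : Ty} :
      HasType K T p τ → HasKind K τ' .star → Ty.Conv τ τ' → HasType K T p τ'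
  | ret {K : List Kind} {T : List Ty} {p : Prog} {τ : Ty} :
      HasType K T p τ → HasType K T (.ret p) (.comp τ)
  | bind {K : List Kind} {T : List Ty} {p₁ p₂ : Prog} {τ₁ τ₂ : Ty} :
      HasType K T p₁ (.comp τ₁) → HasType K (τ₁ :: T) p₂ (.comp τ₂) →
      HasType K T (.bind p₁ p₂) (.comp τ₂)

mutual
/-- The judgment `K | I | T ⊢ e : σ`. -/
inductive HasIndex : List Kind → List Index → List Ty → Expr → Index → Prop
  | var {K : List Kind} {I : List Index} {T : List Ty} {i : ℕ} {σ : Index} :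
      I[i]? = some σ → HasIndex K I T (.var i) σ
  | compr {K : List Kind} {I : List Index} {T : List Ty} {τ : Ty} {σ : Index} {φ : Spec} :
      HasKind K τ .star → IsIndex K σ → IsSpec K (σ :: I) (τ :: T) φ →
      HasIndex K I T (.compr τ σ φ) (.ref τ σ)
  | comprBase {K : List Kind} {I : List Index} {T : List Ty} {τ : Ty} {φ : Spec} :
      HasKind K τ .star → IsSpec K I (τ :: T) φ → HasIndex K I T (.comprBase τ φ) (.refBase τ)
  | tlam {K : List Kind} {I : List Index} {T : List Ty} {κ : Kind} {e : Expr} {σ : Index} :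
      HasIndex (κ :: K) (shiftIndices I) (shiftTys T) e σ → HasIndex K I T (.tlam κ e) (.all κ σ)
  | conv {K : List Kind} {I : List Index} {T : List Ty} {e : Expr} {σ σ' : Index} :
      HasIndex K I T e σ → IsIndex K σ' → Index.Conv σ σ' → HasIndex K I T e σ'
  | tapp {K : List Kind} {I : List Index} {T : List Ty} {κ : Kind} {e : Expr} {σ : Index}
      {τ : Ty} :
      HasIndex K I T e (.all κ σ) → HasKind K τ κ → HasIndex K I T (.tapp e τ) (σ.inst τ)
/-- The judgment `K | I | T ⊢ φ` that a specification is well formed. -/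
inductive IsSpec : List Kind → List Index → List Ty → Spec → Prop
  | mem {K : List Kind} {I : List Index} {T : List Ty} {p : Prog} {e₂ e₁ : Expr} {τ : Ty}
      {σ : Index} :
      HasType K T p τ → HasIndex K I T e₁ σ → HasIndex K I T e₂ (.ref τ σ) →
      IsSpec K I T (.mem p e₂ e₁)
  | memBase {K : List Kind} {I : List Index} {T : List Ty} {p : Prog} {e : Expr} {τ : Ty} :
      HasType K T p τ → HasIndex K I T e (.refBase τ) → IsSpec K I T (.memBase p e)
  | imp {K : List Kind} {I : List Index} {T : List Ty} {φ₁ φ₂ : Spec} :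
      IsSpec K I T φ₁ → IsSpec K I T φ₂ → IsSpec K I T (.imp φ₁ φ₂)
  | after {K : List Kind} {I : List Index} {T : List Ty} {p : Prog} {φ : Spec} {τ : Ty} :
      HasType K T p (.comp τ) → IsSpec K I (τ :: T) φ → IsSpec K I T (.after p φ)
  | allTy {K : List Kind} {I : List Index} {T : List Ty} {κ : Kind} {φ : Spec} :
      IsSpec (κ :: K) (shiftIndices I) (shiftTys T) φ → IsSpec K I T (.allTy κ φ)
  | allProg {K : List Kind} {I : List Index} {T : List Ty} {τ : Ty} {φ : Spec} :
      HasKind K τ .star → IsSpec K I (τ :: T) φ → IsSpec K I T (.allProg τ φ)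
  | allExpr {K : List Kind} {I : List Index} {T : List Ty} {σ : Index} {φ : Spec} :
      IsIndex K σ → IsSpec K (σ :: I) T φ → IsSpec K I T (.allExpr σ φ)
end

/-! #### Derivability -/

/-- Derivability of the sequent `K | I | T ⊢ Φ ⇒ φ`. The typing premises are such that every
sequent in a derivation is well typed. -/
inductive Derivable : List Kind → List Index → List Ty → List Spec → Spec → Prop
  | ax {K : List Kind} {I : List Index} {T : List Ty} {Φ : List Spec} {φ : Spec} :
      (∀ σ ∈ I, IsIndex K σ) → (∀ τ ∈ T, HasKind K τ .star) → (∀ χ ∈ Φ, IsSpec K I T χ) →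
      φ ∈ Φ → Derivable K I T Φ φ
  | impI {K : List Kind} {I : List Index} {T : List Ty} {Φ : List Spec} {φ₁ φ₂ : Spec} :
      Derivable K I T (φ₁ :: Φ) φ₂ → Derivable K I T Φ (.imp φ₁ φ₂)
  | impE {K : List Kind} {I : List Index} {T : List Ty} {Φ : List Spec} {φ₁ φ₂ : Spec} :
      Derivable K I T Φ (.imp φ₁ φ₂) → Derivable K I T Φ φ₁ → Derivable K I T Φ φ₂
  | uniProgI {K : List Kind} {I : List Index} {T : List Ty} {Φ : List Spec} {τ : Ty}
      {φ : Spec} :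
      Derivable K I (τ :: T) (Φ.map (fun χ => χ.ren id Nat.succ id)) φ →
      Derivable K I T Φ (.allProg τ φ)
  | uniProgE {K : List Kind} {I : List Index} {T : List Ty} {Φ : List Spec} {τ : Ty}
      {φ : Spec} {p : Prog} :
      Derivable K I T Φ (.allProg τ φ) → HasType K T p τ → Derivable K I T Φ (φ.instProg p)
  | uniExprI {K : List Kind} {I : List Index} {T : List Ty} {Φ : List Spec} {σ : Index}
      {φ : Spec} :
      Derivable K (σ :: I) T (Φ.map (fun χ => χ.ren id id Nat.succ)) φ →
      Derivable K I T Φ (.allExpr σ φ)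
  | uniExprE {K : List Kind} {I : List Index} {T : List Ty} {Φ : List Spec} {σ : Index}
      {φ : Spec} {e : Expr} :
      Derivable K I T Φ (.allExpr σ φ) → HasIndex K I T e σ → Derivable K I T Φ (φ.instExpr e)
  | uniTyI {K : List Kind} {I : List Index} {T : List Ty} {Φ : List Spec} {κ : Kind}
      {φ : Spec} :
      Derivable (κ :: K) (shiftIndices I) (shiftTys T) (Φ.map (fun χ => χ.ren Nat.succ id id)) φ →
      Derivable K I T Φ (.allTy κ φ)
  | uniTyE {K : List Kind} {I : List Index} {T : List Ty} {Φ : List Spec} {κ : Kind}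
      {φ : Spec} {τ : Ty} :
      Derivable K I T Φ (.allTy κ φ) → HasKind K τ κ → Derivable K I T Φ (φ.instTy τ)
  | modI {K : List Kind} {I : List Index} {T : List Ty} {Φ : List Spec} {τ : Ty}
      {φ : Spec} {p : Prog} :
      Derivable K I T Φ (φ.instProg p) → HasType K T p τ → IsSpec K I (τ :: T) φ →
      Derivable K I T Φ (.after (.ret p) φ)
  /-- `φ` does not depend on the result of `p₁`, so it is shifted past it in the premise. -/
  | modE {K : List Kind} {I : List Index} {T : List Ty} {Φ : List Spec} {φ : Spec}
      {p₁ p₂ : Prog} :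
      Derivable K I T Φ (.after p₁ (.after p₂ (φ.ren id (liftRen Nat.succ) id))) →
      Derivable K I T Φ (.after (.bind p₁ p₂) φ)
  | mon {K : List Kind} {I : List Index} {T : List Ty} {Φ : List Spec} {τ : Ty}
      {φ₁ φ₂ : Spec} {p : Prog} :
      Derivable K I (τ :: T) (φ₁ :: Φ.map (fun χ => χ.ren id Nat.succ id)) φ₂ →
      Derivable K I T Φ (.after p φ₁) → HasType K T p (.comp τ) →
      Derivable K I T Φ (.after p φ₂)
  | memI {K : List Kind} {I : List Index} {T : List Ty} {Φ : List Spec} {τ : Ty}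
      {σ : Index} {φ : Spec} {p : Prog} {e : Expr} :
      Derivable K I T Φ ((φ.instProg p).instExpr e) → HasType K T p τ → HasIndex K I T e σ →
      HasIndex K I T (.compr τ σ φ) (.ref τ σ) → Derivable K I T Φ (.mem p (.compr τ σ φ) e)
  | memE {K : List Kind} {I : List Index} {T : List Ty} {Φ : List Spec} {τ : Ty}
      {σ : Index} {φ : Spec} {p : Prog} {e : Expr} :
      Derivable K I T Φ (.mem p (.compr τ σ φ) e) →
      Derivable K I T Φ ((φ.instProg p).instExpr e)
  | memBaseI {K : List Kind} {I : List Index} {T : List Ty} {Φ : List Spec} {τ : Ty}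
      {φ : Spec} {p : Prog} :
      Derivable K I T Φ (φ.instProg p) → HasType K T p τ →
      HasIndex K I T (.comprBase τ φ) (.refBase τ) →
      Derivable K I T Φ (.memBase p (.comprBase τ φ))
  | memBaseE {K : List Kind} {I : List Index} {T : List Ty} {Φ : List Spec} {τ : Ty}
      {φ : Spec} {p : Prog} :
      Derivable K I T Φ (.memBase p (.comprBase τ φ)) → Derivable K I T Φ (φ.instProg p)
  | conv {K : List Kind} {I : List Index} {T : List Ty} {Φ : List Spec} {φ φ' : Spec} :
      Derivable K I T Φ φ' → Spec.Conv φ φ' → IsSpec K I T φ → Derivable K I T Φ φ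
  | red {K : List Kind} {I : List Index} {T : List Ty} {Φ : List Spec} {τ : Ty}
      {φ : Spec} {p₁ p₂ : Prog} :
      Derivable K I T Φ (φ.instProg p₂) → HasType K T p₁ τ → IsSpec K I (τ :: T) φ →
      Prog.Red p₁ p₂ → Derivable K I T Φ (φ.instProg p₁)

/-- The Hoare triple `{Φ} x ← p {φ}` (with `x` bound in `φ`): the sequent whose conclusion says
that `φ` holds after running `p`. -/
def HoareTriple (K : List Kind) (I : List Index) (T : List Ty) (Φ : List Spec) (p : Prog)
    (φ : Spec) : Prop :=
  Derivable K I T Φ (.after p φ)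

end EffHOL

/-! ### The realizability translation

The variable `u` of higher-order logic with number `i` is translated to the type variable `X_u`
and to the expression variable `y_u`, both with number `i`. -/

namespace HOL

open EffHOL

/-- The translation of sorts to kinds. -/
def Srt.kind : Srt → Kind
  | .star => .star
  | .pred s => .con s.kind

/-- The translation of a sort to an index, depending on a type. -/
def Srt.index : Srt → Ty → Index
  | .star, τ => .refBase τ
  | .pred s, τ => .all s.kind (.ref (.app (τ.ren Nat.succ) (.var 0)) (s.index (.var 0)))

mutual
/-- The translation of terms to types. -/
def Term.ty : Term → Ty
  | .var i => .var i
  | .compr s ψ => .lam s.kind ψ.ty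
  | .comprBase ψ => ψ.ty
/-- The translation of propositions to types (the type of the realizers of `ψ`). -/
def Form.ty : Form → Ty
  | .memBase t => t.ty
  | .mem t₁ t₂ => .app t₂.ty t₁.ty
  | .imp ψ₁ ψ₂ => .arr ψ₁.ty (.comp ψ₂.ty)
  | .all s ψ => .all s.kind (.comp ψ.ty)
end

mutual
/-- The translation of terms to expressions. -/
def Term.expr : Term → Expr
  | .var i => .var i
  | .compr s ψ => .tlam s.kind (.compr ψ.ty (s.index (.var 0)) (ψ.spec (.var 0)))
  | .comprBase ψ => .comprBase ψ.ty (ψ.spec (.var 0))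
/-- `ψ.spec p` is the specification that the program `p` realizes `ψ`. -/
def Form.spec : Form → Prog → Spec
  | .memBase t, p => .memBase p t.expr
  | .mem t₁ t₂, p => .mem p (.tapp t₂.expr t₁.ty) t₁.expr
  | .imp ψ₁ ψ₂, p =>
      .allProg ψ₁.ty
        (.imp (ψ₁.spec (.var 0)) (.after (.app (p.ren id Nat.succ) (.var 0)) (ψ₂.spec (.var 0))))
  | .all s ψ, p =>
      .allTy s.kind (.allExpr (s.index (.var 0))
        (.after (.tapp (p.ren Nat.succ id) (.var 0)) (ψ.spec (.var 0))))
end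

/-- The translation of a sort context to a kind context: `X_u : ⟦s⟧` for every `u : s`. -/
def kindCtx (S : List Srt) : List Kind := S.map Srt.kind

/-- The translation of a sort context to an index context: `y_u : ⟦s⟧_{X_u}` for every `u : s`. -/
def indexCtx : List Srt → List Index
  | [] => []
  | s :: S => s.index (.var 0) :: shiftIndices (indexCtx S)

/-- The translation of hypotheses `ψ₁, …, ψₙ` to a type context: `xᵢ : ⟦ψᵢ⟧`. -/
def tyCtx (Ψ : List Form) : List Ty := Ψ.map Form.ty

/-- The translation of hypotheses `ψ₁, …, ψₙ` to the specifications that `xᵢ` realizes `ψᵢ`. -/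
def specCtx (Ψ : List Form) : List Spec := Ψ.mapIdx (fun i ψ => ψ.spec (.var i))

/-- The program extracted from a derivation: each rule of higher-order logic is mapped to a
construction on programs, which uses the monad only through `ret` and `bind`. -/
def Derivation.realizer : {S : List Srt} → {Ψ : List Form} → {ψ : Form} →
    Derivation S Ψ ψ → Prog
  | _, _, _, .ax i _ _ => .ret (.var i)
  | _, _, _, .impI (ψ₁ := ψ₁) d => .ret (.lam ψ₁.ty d.realizer)
  | _, _, _, .impE d₀ d₁ =>
      .bind d₀.realizer (.bind (d₁.realizer.ren id Nat.succ) (.app (.var 1) (.var 0)))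
  | _, _, _, .uniI (s := s) d => .ret (.tlam s.kind d.realizer)
  | _, _, _, .uniE t d _ => .bind d.realizer (.tapp (.var 0) t.ty)
  | _, _, _, .memI d _ _ => d.realizer
  | _, _, _, .memE d => d.realizer
  | _, _, _, .memBaseI d => d.realizer
  | _, _, _, .memBaseE d => d.realizer

end HOL

/-!
The translation is compositional: it sends a free variable `u` to a type variable and an expression
variable and commutes with substitution up to syntactic equality (`Form.subst_specAt`), because
comprehensions are translated to abstractions and memberships to applications without any reduction
taking place. Apart from the typing of comprehensions (`HasSort.hasIndex`), conversion is needed only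
where higher-order logic itself computes, namely to identify `t ∈ {u : s | ψ}` with `ψ[u := t]`
(`conv_mem_compr`, `conv_tapp_compr`).

The statement to be proved by induction on derivations must survive the extension of contexts by
every binder met on the way. The target calculus has no weakening or substitution rule, so instead
of proving these admissible, soundness is stated for all interpretations at once: the free variables
of the sequent are interpreted by arbitrary well-typed types and expressions, and the hypotheses by
arbitrary programs which realize them according to the list of assumptions (`Interpretation`).
Interpretations extend along hypotheses and variables (`Interpretation.push`,
`Interpretation.lift`), which only needs that *typing* is stable under renaming. Each rule then
becomes a derived rule for the specifications `Form.specAt`, where the specification of a realizer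
is read in an interpretation: a use of a hypothesis is the rule for `ret`, the introduction rules
reduce a `β`-redex applied to a fresh variable, and the elimination rules run their premises in
sequence by the rules for `bind` and monotonicity. The theorem is the case where every variable is
interpreted by its own shift past the additional contexts.
-/

namespace EffHOL

/-! ### Composition of renamings and substitutions -/

theorem liftRen_succ (ξ : ℕ → ℕ) (n : ℕ) : liftRen ξ (n + 1) = ξ n + 1 := rfl

theorem liftRen_id : liftRen id = id := by
  funext n; cases n <;> rfl

/-! #### Types -/

theorem liftTy_var (ξ : ℕ → ℕ) :
    liftTy (fun i => Ty.var (ξ i)) = fun i => Ty.var (liftRen ξ i) := by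
  funext n; cases n <;> rfl

theorem liftTy_comp_liftRen (α : ℕ → Ty) (ξ : ℕ → ℕ) :
    (fun i => liftTy α (liftRen ξ i)) = liftTy (fun i => α (ξ i)) := by
  funext n; cases n <;> rfl

/-- Renaming is a special case of substitution; this reduces equations that mix the two to
composition of substitutions. -/
theorem Ty.ren_eq_subst (τ : Ty) : ∀ ξ, τ.ren ξ = τ.subst (fun i => .var (ξ i)) := by
  induction τ <;> intro ξ <;> simp_all [Ty.ren, Ty.subst, liftTy_var]

theorem Ty.subst_ren (τ : Ty) : ∀ ξ α, (τ.ren ξ).subst α = τ.subst (fun i => α (ξ i)) := by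
  induction τ <;> intro ξ α <;> simp_all [Ty.ren, Ty.subst, liftTy_comp_liftRen]

theorem Ty.ren_ren (τ : Ty) (ξ ξ' : ℕ → ℕ) : (τ.ren ξ).ren ξ' = τ.ren (fun i => ξ' (ξ i)) := by
  rw [Ty.ren_eq_subst _ ξ', Ty.subst_ren, ← Ty.ren_eq_subst]

theorem liftTy_ren (α : ℕ → Ty) (ξ : ℕ → ℕ) :
    (fun i => (liftTy α i).ren (liftRen ξ)) = liftTy (fun i => (α i).ren ξ) := by
  funext n
  cases n with
  | zero => rfl
  | succ n => simp only [liftTy, scons, Ty.ren_ren]; rfl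

theorem Ty.ren_subst (τ : Ty) : ∀ α ξ, (τ.subst α).ren ξ = τ.subst (fun i => (α i).ren ξ) := by
  induction τ <;> intro α ξ <;> simp_all [Ty.ren, Ty.subst, liftTy_ren]

theorem liftTy_subst (α α' : ℕ → Ty) :
    (fun i => (liftTy α i).subst (liftTy α')) = liftTy (fun i => (α i).subst α') := by
  funext n
  cases n with
  | zero => rfl
  | succ n => simp only [liftTy, scons, Ty.subst_ren, Ty.ren_subst]

theorem Ty.subst_subst (τ : Ty) :
    ∀ α α', (τ.subst α).subst α' = τ.subst (fun i => (α i).subst α') := by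
  induction τ <;> intro α α' <;> simp_all [Ty.subst, liftTy_subst]

theorem Ty.subst_var (τ : Ty) : τ.subst Ty.var = τ := by
  have h : liftTy Ty.var = Ty.var := by funext n; cases n <;> rfl
  induction τ <;> simp_all [Ty.subst]

theorem Ty.ren_id (τ : Ty) : τ.ren id = τ := by
  rw [Ty.ren_eq_subst]; exact τ.subst_var

/-! #### Indices -/

theorem Index.ren_eq_subst (σ : Index) : ∀ ξ, σ.ren ξ = σ.subst (fun i => .var (ξ i)) := by
  induction σ <;> intro ξ <;> simp_all [Index.ren, Index.subst, liftTy_var, Ty.ren_eq_subst]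

theorem Index.subst_ren (σ : Index) :
    ∀ ξ α, (σ.ren ξ).subst α = σ.subst (fun i => α (ξ i)) := by
  induction σ <;> intro ξ α <;>
    simp_all [Index.ren, Index.subst, liftTy_comp_liftRen, Ty.subst_ren]

theorem Index.ren_subst (σ : Index) :
    ∀ α ξ, (σ.subst α).ren ξ = σ.subst (fun i => (α i).ren ξ) := by
  induction σ <;> intro α ξ <;> simp_all [Index.ren, Index.subst, liftTy_ren, Ty.ren_subst]

theorem Index.subst_subst (σ : Index) :
    ∀ α α', (σ.subst α).subst α' = σ.subst (fun i => (α i).subst α') := by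
  induction σ <;> intro α α' <;> simp_all [Index.subst, liftTy_subst, Ty.subst_subst]

theorem Index.ren_ren (σ : Index) (ξ ξ' : ℕ → ℕ) :
    (σ.ren ξ).ren ξ' = σ.ren (fun i => ξ' (ξ i)) := by
  rw [Index.ren_eq_subst _ ξ', Index.subst_ren, ← Index.ren_eq_subst]

theorem Index.subst_var (σ : Index) : σ.subst Ty.var = σ := by
  have h : liftTy Ty.var = Ty.var := by funext n; cases n <;> rfl
  induction σ <;> simp_all [Index.subst, Ty.subst_var]

theorem Index.ren_id (σ : Index) : σ.ren id = σ := by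
  rw [Index.ren_eq_subst]; exact σ.subst_var

/-! #### Programs -/

theorem liftProg_var (ζ : ℕ → ℕ) :
    liftProg (fun i => Prog.var (ζ i)) = fun i => Prog.var (liftRen ζ i) := by
  funext n; cases n <;> rfl

theorem liftProg_comp_liftRen (β : ℕ → Prog) (ζ : ℕ → ℕ) :
    (fun i => liftProg β (liftRen ζ i)) = liftProg (fun i => β (ζ i)) := by
  funext n; cases n <;> rfl

theorem Prog.ren_eq_subst (p : Prog) :
    ∀ ξ ζ, p.ren ξ ζ = p.subst (fun i => .var (ξ i)) (fun i => .var (ζ i)) := by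
  induction p <;> intro ξ ζ <;>
    simp_all [Prog.ren, Prog.subst, liftTy_var, liftProg_var, Ty.ren_eq_subst]

theorem Prog.subst_ren (p : Prog) :
    ∀ ξ ζ α β, (p.ren ξ ζ).subst α β = p.subst (fun i => α (ξ i)) (fun i => β (ζ i)) := by
  induction p <;> intro ξ ζ α β <;>
    simp_all [Prog.ren, Prog.subst, liftTy_comp_liftRen, liftProg_comp_liftRen, Ty.subst_ren]

theorem Prog.ren_ren (p : Prog) (ξ ζ ξ' ζ' : ℕ → ℕ) :
    (p.ren ξ ζ).ren ξ' ζ' = p.ren (fun i => ξ' (ξ i)) (fun i => ζ' (ζ i)) := by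
  rw [Prog.ren_eq_subst _ ξ', Prog.subst_ren, ← Prog.ren_eq_subst]

theorem liftProg_ren (β : ℕ → Prog) (ξ ζ : ℕ → ℕ) :
    (fun i => (liftProg β i).ren ξ (liftRen ζ)) = liftProg (fun i => (β i).ren ξ ζ) := by
  funext n
  cases n with
  | zero => rfl
  | succ n => simp only [liftProg, scons, Prog.ren_ren]; rfl

theorem Prog.ren_subst (p : Prog) : ∀ α β ξ ζ,
    (p.subst α β).ren ξ ζ = p.subst (fun i => (α i).ren ξ) (fun i => (β i).ren ξ ζ) := by
  induction p <;> intro α β ξ ζ <;>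
    simp_all [Prog.ren, Prog.subst, liftTy_ren, liftProg_ren, Ty.ren_subst, Prog.ren_ren,
      liftRen_succ]

theorem liftProg_subst (β : ℕ → Prog) (α : ℕ → Ty) (β' : ℕ → Prog) :
    (fun i => (liftProg β i).subst α (liftProg β')) =
      liftProg (fun i => (β i).subst α β') := by
  funext n
  cases n with
  | zero => rfl
  | succ n => simp [liftProg, scons, Prog.subst_ren, Prog.ren_subst, Ty.ren_id]

theorem Prog.subst_subst (p : Prog) : ∀ α β α' β',
    (p.subst α β).subst α' β' =
      p.subst (fun i => (α i).subst α') (fun i => (β i).subst α' β') := by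
  induction p <;> intro α β α' β' <;>
    simp_all [Prog.subst, liftTy_subst, liftProg_subst, Ty.subst_subst, Prog.subst_ren,
      Prog.ren_subst]
  rfl

theorem Prog.subst_var (p : Prog) : p.subst Ty.var Prog.var = p := by
  have h : liftTy Ty.var = Ty.var := by funext n; cases n <;> rfl
  have h' : liftProg Prog.var = Prog.var := by funext n; cases n <;> rfl
  induction p <;> simp_all [Prog.subst, Prog.ren, Ty.subst_var]

theorem Prog.ren_id (p : Prog) : p.ren id id = p := by
  rw [Prog.ren_eq_subst]; exact p.subst_var

/-! #### Expressions and specifications -/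

theorem liftExpr_var (η : ℕ → ℕ) :
    liftExpr (fun i => Expr.var (η i)) = fun i => Expr.var (liftRen η i) := by
  funext n; cases n <;> rfl

theorem liftExpr_comp_liftRen (γ : ℕ → Expr) (η : ℕ → ℕ) :
    (fun i => liftExpr γ (liftRen η i)) = liftExpr (fun i => γ (η i)) := by
  funext n; cases n <;> rfl

mutual
theorem Expr.ren_eq_subst (e : Expr) (ξ ζ η : ℕ → ℕ) :
    e.ren ξ ζ η = e.subst (fun i => .var (ξ i)) (fun i => .var (ζ i)) (fun i => .var (η i)) := by
  cases e <;> simp [Expr.ren, Expr.subst, liftTy_var, liftProg_var, liftExpr_var, Prog.ren,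
    Ty.ren_eq_subst, Index.ren_eq_subst, Expr.ren_eq_subst, Spec.ren_eq_subst]
theorem Spec.ren_eq_subst (φ : Spec) (ξ ζ η : ℕ → ℕ) :
    φ.ren ξ ζ η = φ.subst (fun i => .var (ξ i)) (fun i => .var (ζ i)) (fun i => .var (η i)) := by
  cases φ <;> simp [Spec.ren, Spec.subst, liftTy_var, liftProg_var, liftExpr_var, Expr.ren,
    Prog.ren, Ty.ren_eq_subst, Index.ren_eq_subst, Prog.ren_eq_subst, Expr.ren_eq_subst,
    Spec.ren_eq_subst]
end

mutual
theorem Expr.subst_ren (e : Expr) (ξ ζ η : ℕ → ℕ) (α : ℕ → Ty) (β : ℕ → Prog) (γ : ℕ → Expr) :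
    (e.ren ξ ζ η).subst α β γ =
      e.subst (fun i => α (ξ i)) (fun i => β (ζ i)) (fun i => γ (η i)) := by
  cases e <;> simp [Expr.ren, Expr.subst, liftTy_comp_liftRen, liftProg_comp_liftRen,
    liftExpr_comp_liftRen, Ty.subst_ren, Index.subst_ren, Expr.subst_ren, Spec.subst_ren]
theorem Spec.subst_ren (φ : Spec) (ξ ζ η : ℕ → ℕ) (α : ℕ → Ty) (β : ℕ → Prog) (γ : ℕ → Expr) :
    (φ.ren ξ ζ η).subst α β γ =
      φ.subst (fun i => α (ξ i)) (fun i => β (ζ i)) (fun i => γ (η i)) := by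
  cases φ <;> simp [Spec.ren, Spec.subst, liftTy_comp_liftRen, liftProg_comp_liftRen,
    liftExpr_comp_liftRen, Ty.subst_ren, Index.subst_ren, Prog.subst_ren, Expr.subst_ren,
    Spec.subst_ren]
end

theorem Expr.ren_ren (e : Expr) (ξ ζ η ξ' ζ' η' : ℕ → ℕ) :
    (e.ren ξ ζ η).ren ξ' ζ' η' =
      e.ren (fun i => ξ' (ξ i)) (fun i => ζ' (ζ i)) (fun i => η' (η i)) := by
  rw [Expr.ren_eq_subst _ ξ', Expr.subst_ren, ← Expr.ren_eq_subst]

theorem liftExpr_ren (γ : ℕ → Expr) (ξ ζ η : ℕ → ℕ) :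
    (fun i => (liftExpr γ i).ren ξ ζ (liftRen η)) = liftExpr (fun i => (γ i).ren ξ ζ η) := by
  funext n
  cases n with
  | zero => rfl
  | succ n => simp only [liftExpr, scons, Expr.ren_ren]; rfl

mutual
theorem Expr.ren_subst (e : Expr) (α : ℕ → Ty) (β : ℕ → Prog) (γ : ℕ → Expr) (ξ ζ η : ℕ → ℕ) :
    (e.subst α β γ).ren ξ ζ η =
      e.subst (fun i => (α i).ren ξ) (fun i => (β i).ren ξ ζ) (fun i => (γ i).ren ξ ζ η) := by
  cases e <;> simp [Expr.ren, Expr.subst, liftTy_ren, liftProg_ren, liftExpr_ren, liftRen_succ,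
    Ty.ren_subst, Index.ren_subst, Prog.ren_ren, Expr.ren_ren, Expr.ren_subst, Spec.ren_subst]
theorem Spec.ren_subst (φ : Spec) (α : ℕ → Ty) (β : ℕ → Prog) (γ : ℕ → Expr) (ξ ζ η : ℕ → ℕ) :
    (φ.subst α β γ).ren ξ ζ η =
      φ.subst (fun i => (α i).ren ξ) (fun i => (β i).ren ξ ζ) (fun i => (γ i).ren ξ ζ η) := by
  cases φ <;> simp [Spec.ren, Spec.subst, liftTy_ren, liftProg_ren, liftExpr_ren, liftRen_succ,
    Ty.ren_subst, Index.ren_subst, Prog.ren_ren, Prog.ren_subst, Expr.ren_ren, Expr.ren_subst,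
    Spec.ren_subst]
end

theorem liftExpr_subst (γ : ℕ → Expr) (α : ℕ → Ty) (β : ℕ → Prog) (γ' : ℕ → Expr) :
    (fun i => (liftExpr γ i).subst α β (liftExpr γ')) =
      liftExpr (fun i => (γ i).subst α β γ') := by
  funext n
  cases n with
  | zero => rfl
  | succ n => simp [liftExpr, scons, Expr.subst_ren, Expr.ren_subst, Ty.ren_id, Prog.ren_id]

theorem liftTy_succ (α : ℕ → Ty) (n : ℕ) : liftTy α (n + 1) = (α n).ren Nat.succ := rfl

theorem liftProg_succ (β : ℕ → Prog) (n : ℕ) :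
    liftProg β (n + 1) = (β n).ren id Nat.succ := rfl

theorem liftExpr_succ (γ : ℕ → Expr) (n : ℕ) :
    liftExpr γ (n + 1) = (γ n).ren id id Nat.succ := rfl

mutual
theorem Expr.subst_subst (e : Expr) (α : ℕ → Ty) (β : ℕ → Prog) (γ : ℕ → Expr)
    (α' : ℕ → Ty) (β' : ℕ → Prog) (γ' : ℕ → Expr) :
    (e.subst α β γ).subst α' β' γ' =
      e.subst (fun i => (α i).subst α') (fun i => (β i).subst α' β')
        (fun i => (γ i).subst α' β' γ') := by
  cases e <;> simp [Expr.subst, liftTy_subst, liftProg_subst, liftExpr_subst, liftTy_succ,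
    liftProg_succ, Ty.subst_subst, Index.subst_subst, Prog.subst_ren, Prog.ren_subst,
    Expr.subst_ren, Expr.ren_subst, Ty.ren_id, Expr.subst_subst, Spec.subst_subst]
theorem Spec.subst_subst (φ : Spec) (α : ℕ → Ty) (β : ℕ → Prog) (γ : ℕ → Expr)
    (α' : ℕ → Ty) (β' : ℕ → Prog) (γ' : ℕ → Expr) :
    (φ.subst α β γ).subst α' β' γ' =
      φ.subst (fun i => (α i).subst α') (fun i => (β i).subst α' β')
        (fun i => (γ i).subst α' β' γ') := by
  cases φ <;> simp [Spec.subst, liftTy_subst, liftProg_subst, liftExpr_subst, liftTy_succ,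
    liftProg_succ, Ty.subst_subst, Index.subst_subst, Prog.subst_subst, Prog.subst_ren,
    Prog.ren_subst, Expr.subst_ren, Expr.ren_subst, Ty.ren_id, Expr.subst_subst,
    Spec.subst_subst]
end

theorem liftTy_eq_var : liftTy Ty.var = Ty.var := by funext n; cases n <;> rfl

theorem liftProg_eq_var : liftProg Prog.var = Prog.var := by funext n; cases n <;> rfl

theorem liftExpr_eq_var : liftExpr Expr.var = Expr.var := by funext n; cases n <;> rfl

mutual
theorem Expr.subst_var (e : Expr) : e.subst Ty.var Prog.var Expr.var = e := by
  cases e <;> simp [Expr.subst, liftTy_eq_var, liftProg_eq_var, liftExpr_eq_var, Prog.ren,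
    Expr.ren, Ty.subst_var, Index.subst_var, Expr.subst_var, Spec.subst_var]
theorem Spec.subst_var (φ : Spec) : φ.subst Ty.var Prog.var Expr.var = φ := by
  cases φ <;> simp [Spec.subst, liftTy_eq_var, liftProg_eq_var, liftExpr_eq_var, Prog.ren,
    Expr.ren, Ty.subst_var, Index.subst_var, Prog.subst_var, Expr.subst_var, Spec.subst_var]
end

theorem Ty.subst_liftTy_inst (τ τ' : Ty) (α : ℕ → Ty) :
    (τ.subst (liftTy α)).inst τ' = τ.subst (scons τ' α) := by
  rw [Ty.inst, Ty.subst_subst]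
  congr 1; funext n
  cases n with
  | zero => rfl
  | succ n => simp only [liftTy_succ, Ty.subst_ren, scons]; exact Ty.subst_var _

theorem Prog.ren_subst_liftProg (p : Prog) (α : ℕ → Ty) (β : ℕ → Prog) :
    (p.ren id Nat.succ).subst α (liftProg β) = p.subst α (fun i => liftProg β (i + 1)) :=
  p.subst_ren ..

/-! ### Renaming preserves conversion and typing -/

theorem ren_scons_var (τ : Ty) (ξ : ℕ → ℕ) :
    (fun i => (scons τ Ty.var i).ren ξ) =
      fun i => scons (τ.ren ξ) Ty.var (liftRen ξ i) := by
  funext n; cases n <;> rfl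

theorem Ty.inst_ren (τ τ' : Ty) (ξ : ℕ → ℕ) :
    (τ.inst τ').ren ξ = (τ.ren (liftRen ξ)).inst (τ'.ren ξ) := by
  simp only [Ty.inst, Ty.ren_subst, Ty.subst_ren, ren_scons_var]

theorem Index.inst_ren (σ : Index) (τ : Ty) (ξ : ℕ → ℕ) :
    (σ.inst τ).ren ξ = (σ.ren (liftRen ξ)).inst (τ.ren ξ) := by
  simp only [Index.inst, Index.ren_subst, Index.subst_ren, ren_scons_var]

theorem Ty.Conv.ren {τ τ' : Ty} (h : Ty.Conv τ τ') :
    ∀ ξ, Ty.Conv (τ.ren ξ) (τ'.ren ξ) := by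
  induction h with
  | beta κ τ₁ τ₂ => intro ξ; rw [Ty.inst_ren]; exact .beta ..
  | comp _ ih => exact fun ξ => .comp (ih ξ)
  | symm _ ih => exact fun ξ => .symm (ih ξ)
  | trans _ _ ih ih' => exact fun ξ => .trans (ih ξ) (ih' ξ)
  | app _ _ ih ih' => exact fun ξ => .app (ih ξ) (ih' ξ)
  | lam _ ih => exact fun ξ => .lam (ih _)
  | arr _ _ ih ih' => exact fun ξ => .arr (ih ξ) (ih' ξ)
  | all _ ih => exact fun ξ => .all (ih _)
  | refl τ => exact fun ξ => .refl _

theorem Index.Conv.ren {σ σ' : Index} (h : Index.Conv σ σ') :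
    ∀ ξ, Index.Conv (σ.ren ξ) (σ'.ren ξ) := by
  induction h with
  | symm _ ih => exact fun ξ => .symm (ih ξ)
  | trans _ _ ih ih' => exact fun ξ => .trans (ih ξ) (ih' ξ)
  | refBase h => exact fun ξ => .refBase (h.ren ξ)
  | ref h _ ih => exact fun ξ => .ref (h.ren ξ) (ih ξ)
  | all _ ih => exact fun ξ => .all (ih _)
  | refl σ => exact fun ξ => .refl _

/-- `ξ` maps the type variables of `K` to variables of the same kind in `K'`. -/
def KindRen (K K' : List Kind) (ξ : ℕ → ℕ) : Prop :=
  ∀ i κ, K[i]? = some κ → K'[ξ i]? = some κ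

/-- `ζ` maps the program variables of `T` to variables of `T'` whose type is renamed by `ξ`. -/
def TyRen (T T' : List Ty) (ξ ζ : ℕ → ℕ) : Prop :=
  ∀ i τ, T[i]? = some τ → T'[ζ i]? = some (τ.ren ξ)

/-- `η` maps the expression variables of `I` to variables of `I'` whose index is renamed
by `ξ`. -/
def IndexRen (I I' : List Index) (ξ η : ℕ → ℕ) : Prop :=
  ∀ i σ, I[i]? = some σ → I'[η i]? = some (σ.ren ξ)

theorem KindRen.lift {K K' : List Kind} {ξ : ℕ → ℕ} (h : KindRen K K' ξ) (κ : Kind) :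
    KindRen (κ :: K) (κ :: K') (liftRen ξ)
  | 0, _, e => e
  | i + 1, κ', e => h i κ' e

theorem KindRen.refl (K : List Kind) : KindRen K K id := fun _ _ e => e

theorem KindRen.succ (K : List Kind) (κ : Kind) : KindRen K (κ :: K) Nat.succ := fun _ _ e => e

theorem TyRen.lift {T T' : List Ty} {ξ ζ : ℕ → ℕ} (h : TyRen T T' ξ ζ) (τ : Ty) :
    TyRen (τ :: T) (τ.ren ξ :: T') ξ (liftRen ζ)
  | 0, _, e => by cases e; rfl
  | i + 1, τ', e => h i τ' e

theorem TyRen.refl (T : List Ty) : TyRen T T id id := fun _ _ e => by rwa [Ty.ren_id]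

theorem TyRen.succ (T : List Ty) (τ : Ty) : TyRen T (τ :: T) id Nat.succ :=
  fun _ _ e => by rwa [Ty.ren_id]

theorem TyRen.shift {T T' : List Ty} {ξ ζ : ℕ → ℕ} (h : TyRen T T' ξ ζ) :
    TyRen (shiftTys T) (shiftTys T') (liftRen ξ) ζ := by
  intro i τ e
  simp only [shiftTys, List.getElem?_map, Option.map_eq_some_iff] at e ⊢
  obtain ⟨τ₀, e, rfl⟩ := e
  exact ⟨_, h i τ₀ e, by simp only [Ty.ren_ren]; rfl⟩

theorem TyRen.shiftTys (T : List Ty) : TyRen T (shiftTys T) Nat.succ id := by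
  intro i τ e
  simp [EffHOL.shiftTys, e]

theorem IndexRen.lift {I I' : List Index} {ξ η : ℕ → ℕ} (h : IndexRen I I' ξ η) (σ : Index) :
    IndexRen (σ :: I) (σ.ren ξ :: I') ξ (liftRen η)
  | 0, _, e => by cases e; rfl
  | i + 1, σ', e => h i σ' e

theorem IndexRen.refl (I : List Index) : IndexRen I I id id := fun _ _ e => by rwa [Index.ren_id]

theorem IndexRen.succ (I : List Index) (σ : Index) : IndexRen I (σ :: I) id Nat.succ :=
  fun _ _ e => by rwa [Index.ren_id]

theorem IndexRen.shift {I I' : List Index} {ξ η : ℕ → ℕ} (h : IndexRen I I' ξ η) :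
    IndexRen (shiftIndices I) (shiftIndices I') (liftRen ξ) η := by
  intro i σ e
  simp only [shiftIndices, List.getElem?_map, Option.map_eq_some_iff] at e ⊢
  obtain ⟨σ₀, e, rfl⟩ := e
  exact ⟨_, h i σ₀ e, by simp only [Index.ren_ren]; rfl⟩

theorem IndexRen.shiftIndices (I : List Index) : IndexRen I (shiftIndices I) Nat.succ id := by
  intro i σ e
  simp [EffHOL.shiftIndices, e]

theorem HasKind.ren {K : List Kind} {τ : Ty} {κ : Kind} (h : HasKind K τ κ) :
    ∀ {K' ξ}, KindRen K K' ξ → HasKind K' (τ.ren ξ) κ := by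
  induction h with
  | var e => exact fun r => .var (r _ _ e)
  | app _ _ ih ih' => exact fun r => .app (ih r) (ih' r)
  | lam _ ih => exact fun r => .lam (ih (r.lift _))
  | arr _ _ ih ih' => exact fun r => .arr (ih r) (ih' r)
  | all _ ih => exact fun r => .all (ih (r.lift _))
  | comp _ ih => exact fun r => .comp (ih r)

theorem IsIndex.ren {K : List Kind} {σ : Index} (h : IsIndex K σ) :
    ∀ {K' ξ}, KindRen K K' ξ → IsIndex K' (σ.ren ξ) := by
  induction h with
  | refBase h => exact fun r => .refBase (h.ren r)
  | ref h _ ih => exact fun r => .ref (h.ren r) (ih r)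
  | all _ ih => exact fun r => .all (ih (r.lift _))

theorem HasType.ren {K : List Kind} {T : List Ty} {p : Prog} {τ : Ty} (h : HasType K T p τ) :
    ∀ {K' T' ξ ζ}, KindRen K K' ξ → TyRen T T' ξ ζ → HasType K' T' (p.ren ξ ζ) (τ.ren ξ) := by
  induction h with
  | var e => exact fun _ r => .var (r _ _ e)
  | tlam _ ih => exact fun k r => .tlam (ih (k.lift _) r.shift)
  | lam h _ ih => exact fun k r => .lam (h.ren k) (ih k (r.lift _))
  | tapp _ h ih =>
    intro K' T' ξ ζ k r
    rw [Ty.inst_ren]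
    exact .tapp (ih k r) (h.ren k)
  | app _ _ ih ih' => exact fun k r => .app (ih k r) (ih' k r)
  | conv _ h c ih => exact fun k r => .conv (ih k r) (h.ren k) (c.ren _)
  | ret _ ih => exact fun k r => .ret (ih k r)
  | bind _ _ ih ih' => exact fun k r => .bind (ih k r) (ih' k (r.lift _))

mutual
theorem HasIndex.ren {K : List Kind} {I : List Index} {T : List Ty} {e : Expr} {σ : Index}
    (h : HasIndex K I T e σ) : ∀ {K' I' T' ξ ζ η}, KindRen K K' ξ → IndexRen I I' ξ η →
      TyRen T T' ξ ζ → HasIndex K' I' T' (e.ren ξ ζ η) (σ.ren ξ) := by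
  intro K' I' T' ξ ζ η k i t
  match h with
  | .var e => exact .var (i _ _ e)
  | .compr h h' h'' =>
    exact .compr (h.ren k) (h'.ren k) (IsSpec.ren h'' k (i.lift _) (t.lift _))
  | .comprBase h h' => exact .comprBase (h.ren k) (IsSpec.ren h' k i (t.lift _))
  | .tlam h => exact .tlam (HasIndex.ren h (k.lift _) i.shift t.shift)
  | .conv h h' c => exact .conv (HasIndex.ren h k i t) (h'.ren k) (c.ren _)
  | .tapp h h' =>
    rw [Index.inst_ren]
    exact .tapp (HasIndex.ren h k i t) (h'.ren k)
theorem IsSpec.ren {K : List Kind} {I : List Index} {T : List Ty} {φ : Spec}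
    (h : IsSpec K I T φ) : ∀ {K' I' T' ξ ζ η}, KindRen K K' ξ → IndexRen I I' ξ η →
      TyRen T T' ξ ζ → IsSpec K' I' T' (φ.ren ξ ζ η) := by
  intro K' I' T' ξ ζ η k i t
  match h with
  | .mem h h₁ h₂ => exact .mem (h.ren k t) (HasIndex.ren h₁ k i t) (HasIndex.ren h₂ k i t)
  | .memBase h h' => exact .memBase (h.ren k t) (HasIndex.ren h' k i t)
  | .imp h h' => exact .imp (IsSpec.ren h k i t) (IsSpec.ren h' k i t)
  | .after h h' => exact .after (h.ren k t) (IsSpec.ren h' k i (t.lift _))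
  | .allTy h => exact .allTy (IsSpec.ren h (k.lift _) i.shift t.shift)
  | .allProg h h' => exact .allProg (h.ren k) (IsSpec.ren h' k i (t.lift _))
  | .allExpr h h' => exact .allExpr (h.ren k) (IsSpec.ren h' k (i.lift _) t)
end

/-- The body of an abstraction is recovered by applying the shifted abstraction to the variable
bound last. -/
theorem liftRen_inst_var (τ : Ty) : (τ.ren (liftRen Nat.succ)).inst (.var 0) = τ := by
  rw [Ty.inst, Ty.subst_ren]
  refine Eq.trans ?_ τ.subst_var
  congr 1; funext n; cases n <;> rfl

theorem HasType.weakenProg {K : List Kind} {T : List Ty} {p : Prog} {τ : Ty}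
    (h : HasType K T p τ) (τ' : Ty) : HasType K (τ' :: T) (p.ren id Nat.succ) τ := by
  have := h.ren (.refl _) (.succ T τ')
  rwa [Ty.ren_id] at this

end EffHOL

namespace HOL

open EffHOL

/-! ### Well-formedness in higher-order logic -/

/-- `ξ` maps the variables of `S` to variables of the same sort in `S'`. -/
def SrtRen (S S' : List Srt) (ξ : ℕ → ℕ) : Prop :=
  ∀ i, S'[ξ i]? = S[i]?

theorem SrtRen.lift {S S' : List Srt} {ξ : ℕ → ℕ} (h : SrtRen S S' ξ) (s : Srt) :
    SrtRen (s :: S) (s :: S') (liftRen ξ)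
  | 0 => rfl
  | i + 1 => h i

mutual
theorem Term.hasSort_ren_iff (t : Term) {S S' : List Srt} {ξ : ℕ → ℕ} {s : Srt}
    (r : SrtRen S S' ξ) : HasSort S' (t.ren ξ) s ↔ HasSort S t s := by
  cases t with
  | var i =>
    constructor <;> rintro (e | _ | _)
    · exact .var (by rwa [← r i])
    · exact .var (by rwa [r i])
  | compr s' ψ =>
    constructor <;> rintro (_ | h | _)
    · exact .compr ((Form.isForm_ren_iff ψ (r.lift _)).1 h)
    · exact .compr ((Form.isForm_ren_iff ψ (r.lift _)).2 h)
  | comprBase ψ =>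
    constructor <;> rintro (_ | _ | h)
    · exact .comprBase ((Form.isForm_ren_iff ψ r).1 h)
    · exact .comprBase ((Form.isForm_ren_iff ψ r).2 h)
/-- The direction from left to right strengthens contexts: `∀`-introduction has its hypotheses
shifted in the premise, and they must be well formed before the shift. -/
theorem Form.isForm_ren_iff (ψ : Form) {S S' : List Srt} {ξ : ℕ → ℕ}
    (r : SrtRen S S' ξ) : IsForm S' (ψ.ren ξ) ↔ IsForm S ψ := by
  cases ψ with
  | memBase t =>
    constructor <;> rintro ⟨h⟩
    · exact .memBase ((Term.hasSort_ren_iff t r).1 h)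
    · exact .memBase ((Term.hasSort_ren_iff t r).2 h)
  | mem t₁ t₂ =>
    constructor <;> rintro (_ | ⟨h₁, h₂⟩)
    · exact .mem ((Term.hasSort_ren_iff t₁ r).1 h₁) ((Term.hasSort_ren_iff t₂ r).1 h₂)
    · exact .mem ((Term.hasSort_ren_iff t₁ r).2 h₁) ((Term.hasSort_ren_iff t₂ r).2 h₂)
  | imp ψ₁ ψ₂ =>
    constructor <;> rintro (_ | _ | ⟨h₁, h₂⟩)
    · exact .imp ((Form.isForm_ren_iff ψ₁ r).1 h₁) ((Form.isForm_ren_iff ψ₂ r).1 h₂)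
    · exact .imp ((Form.isForm_ren_iff ψ₁ r).2 h₁) ((Form.isForm_ren_iff ψ₂ r).2 h₂)
  | all s ψ =>
    constructor <;> rintro (_ | _ | _ | h)
    · exact .all ((Form.isForm_ren_iff ψ (r.lift _)).1 h)
    · exact .all ((Form.isForm_ren_iff ψ (r.lift _)).2 h)
end

theorem isForm_ren_succ {S : List Srt} {s : Srt} {ψ : Form} :
    IsForm (s :: S) (ψ.ren Nat.succ) ↔ IsForm S ψ :=
  ψ.isForm_ren_iff fun _ => rfl

theorem hasSort_liftSub {S S' : List Srt} {θ : ℕ → Term}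
    (h : ∀ i s, S[i]? = some s → HasSort S' (θ i) s) (s' : Srt) :
    ∀ i s, (s' :: S)[i]? = some s → HasSort (s' :: S') (liftSub θ i) s
  | 0, _, e => .var e
  | i + 1, s, e => (Term.hasSort_ren_iff _ (ξ := Nat.succ) fun _ => rfl).2 (h i s e)

mutual
theorem HasSort.subst {S S' : List Srt} {t : Term} {s : Srt} {θ : ℕ → Term}
    (h : HasSort S t s) (hθ : ∀ i s, S[i]? = some s → HasSort S' (θ i) s) :
    HasSort S' (t.subst θ) s := by
  match h with
  | .var e => exact hθ _ _ e
  | .compr h => exact .compr (IsForm.subst h (hasSort_liftSub hθ _))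
  | .comprBase h => exact .comprBase (IsForm.subst h hθ)
theorem IsForm.subst {S S' : List Srt} {ψ : Form} {θ : ℕ → Term}
    (h : IsForm S ψ) (hθ : ∀ i s, S[i]? = some s → HasSort S' (θ i) s) :
    IsForm S' (ψ.subst θ) := by
  match h with
  | .memBase h => exact .memBase (HasSort.subst h hθ)
  | .mem h h' => exact .mem (HasSort.subst h hθ) (HasSort.subst h' hθ)
  | .imp h h' => exact .imp (IsForm.subst h hθ) (IsForm.subst h' hθ)
  | .all h => exact .all (IsForm.subst h (hasSort_liftSub hθ _))
end

theorem IsForm.inst {S : List Srt} {s : Srt} {ψ : Form} {t : Term} (h : IsForm (s :: S) ψ)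
    (ht : HasSort S t s) : IsForm S (ψ.inst t) :=
  h.subst fun
    | 0, _, e => by cases e; exact ht
    | _ + 1, _, e => .var e

/-- Only well-formed sequents are derivable. -/
theorem Derivation.isForm {S : List Srt} {Ψ : List Form} {ψ : Form} (d : Derivation S Ψ ψ) :
    (∀ χ ∈ Ψ, IsForm S χ) ∧ IsForm S ψ := by
  induction d with
  | ax i h e => exact ⟨h, h _ (List.mem_of_getElem? e)⟩
  | impI _ ih =>
    exact ⟨fun χ hχ => ih.1 χ (.tail _ hχ), .imp (ih.1 _ (.head _)) ih.2⟩
  | impE _ _ ih _ =>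
    obtain ⟨h, _ | _ | ⟨_, h'⟩⟩ := ih
    exact ⟨h, h'⟩
  | uniI _ ih =>
    exact ⟨fun χ hχ => isForm_ren_succ.1 (ih.1 _ (List.mem_map_of_mem hχ)), .all ih.2⟩
  | uniE t _ ht ih =>
    obtain ⟨h, _ | _ | _ | h'⟩ := ih
    exact ⟨h, h'.inst ht⟩
  | memI _ ht h ih => exact ⟨ih.1, .mem ht (.compr h)⟩
  | memE _ ih =>
    obtain ⟨h, _ | ⟨ht, _ | h' | _⟩⟩ := ih
    exact ⟨h, h'.inst ht⟩
  | memBaseI _ ih => exact ⟨ih.1, .memBase (.comprBase ih.2)⟩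
  | memBaseE _ ih =>
    obtain ⟨h, ⟨_ | _ | h'⟩⟩ := ih
    exact ⟨h, h'⟩


theorem liftExpr_ren_id (γ : ℕ → Expr) (ξ ζ : ℕ → ℕ) :
    (fun i => (liftExpr γ i).ren ξ ζ id) = liftExpr (fun i => (γ i).ren ξ ζ id) := by
  rw [← liftExpr_ren, liftRen_id]

/-! ### The translation in an environment -/

theorem Srt.index_subst (s : Srt) : ∀ τ α, (s.index τ).subst α = s.index (τ.subst α) := by
  induction s with
  | star => intro τ α; rfl
  | pred s ih =>
    intro τ α
    simp [Srt.index, Index.subst, Ty.subst, ih, Ty.subst_ren, Ty.ren_subst, liftTy_succ]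
    exact ⟨rfl, rfl⟩

theorem Srt.index_ren (s : Srt) (τ : Ty) (ξ : ℕ → ℕ) : (s.index τ).ren ξ = s.index (τ.ren ξ) := by
  rw [Index.ren_eq_subst, Srt.index_subst, Ty.ren_eq_subst]

mutual
theorem Term.expr_subst_irrel (t : Term) (α : ℕ → Ty) (β β' : ℕ → Prog) (γ : ℕ → Expr) :
    t.expr.subst α β γ = t.expr.subst α β' γ := by
  cases t with
  | var i => rfl
  | compr s ψ =>
    simp only [Term.expr, Expr.subst]
    rw [Form.spec_subst_irrel ψ (.var 0) (.var 0)]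
    rfl
  | comprBase ψ =>
    simp only [Term.expr, Expr.subst]
    rw [Form.spec_subst_irrel ψ (.var 0) (.var 0)]
    rfl
/-- The program variables of `ψ.spec p` are those of `p`. -/
theorem Form.spec_subst_irrel (ψ : Form) (p p' : Prog) (α : ℕ → Ty) (β β' : ℕ → Prog)
    (γ : ℕ → Expr) (h : p.subst α β = p'.subst α β') :
    (ψ.spec p).subst α β γ = (ψ.spec p').subst α β' γ := by
  cases ψ with
  | memBase t =>
    simp only [Form.spec, Spec.subst, h]
    rw [Term.expr_subst_irrel t]
  | mem t₁ t₂ =>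
    simp only [Form.spec, Spec.subst, Expr.subst, h]
    rw [Term.expr_subst_irrel t₁, Term.expr_subst_irrel t₂]
  | imp ψ₁ ψ₂ =>
    simp only [Form.spec, Spec.subst, Prog.subst]
    rw [Form.spec_subst_irrel ψ₁ (.var 0) (.var 0) _ (liftProg β) (liftProg β') _ rfl,
      Form.spec_subst_irrel ψ₂ (.var 0) (.var 0) _ (liftProg (liftProg β))
        (liftProg (liftProg β')) _ rfl]
    have h' := congrArg (Prog.ren · id Nat.succ) h
    simp only [Prog.ren_subst] at h'
    simp only [Prog.subst_ren, liftProg_succ, Nat.succ_eq_add_one, id, Ty.ren_id] at h' ⊢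
    rw [h']
    rfl
  | all s ψ =>
    simp only [Form.spec, Spec.subst, Prog.subst]
    rw [Form.spec_subst_irrel ψ (.var 0) (.var 0) _ (liftProg (fun n => (β n).ren Nat.succ id))
      (liftProg (fun n => (β' n).ren Nat.succ id)) _ rfl]
    have h' := congrArg (Prog.ren · Nat.succ id) h
    simp only [Prog.ren_subst] at h'
    simp only [Prog.subst_ren, liftTy_succ, Nat.succ_eq_add_one, id] at h' ⊢
    rw [h']
end

/-- The translation of `t` to an expression when the type and expression variables of its free
variables are interpreted by `α` and `γ`. It has no program variables to be interpreted. -/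
def Term.exprAt (t : Term) (α : ℕ → Ty) (γ : ℕ → Expr) : Expr :=
  t.expr.subst α Prog.var γ

/-- The specification that `p` realizes `ψ` when the type and expression variables of the free
variables of `ψ` are interpreted by `α` and `γ`. -/
def Form.specAt (ψ : Form) (α : ℕ → Ty) (γ : ℕ → Expr) (p : Prog) : Spec :=
  (ψ.spec (.var 0)).subst α (scons p Prog.var) γ

theorem Term.expr_subst (t : Term) (α : ℕ → Ty) (β : ℕ → Prog) (γ : ℕ → Expr) :
    t.expr.subst α β γ = t.exprAt α γ :=
  t.expr_subst_irrel ..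

theorem Form.spec_subst (ψ : Form) (p : Prog) (α : ℕ → Ty) (β : ℕ → Prog) (γ : ℕ → Expr) :
    (ψ.spec p).subst α β γ = ψ.specAt α γ (p.subst α β) :=
  ψ.spec_subst_irrel _ _ _ _ _ _ rfl

theorem Form.specAt_subst (ψ : Form) (α : ℕ → Ty) (γ : ℕ → Expr) (p : Prog) (α' : ℕ → Ty)
    (β' : ℕ → Prog) (γ' : ℕ → Expr) : (ψ.specAt α γ p).subst α' β' γ' =
      ψ.specAt (fun i => (α i).subst α') (fun i => (γ i).subst α' β' γ') (p.subst α' β') := by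
  rw [Form.specAt, Spec.subst_subst, Form.spec_subst]
  rfl

theorem Term.exprAt_ren (t : Term) (α : ℕ → Ty) (γ : ℕ → Expr) (ξ ζ η : ℕ → ℕ) :
    (t.exprAt α γ).ren ξ ζ η =
      t.exprAt (fun i => (α i).ren ξ) (fun i => (γ i).ren ξ ζ η) := by
  rw [Term.exprAt, Expr.ren_subst, Term.expr_subst]

theorem Form.specAt_ren (ψ : Form) (α : ℕ → Ty) (γ : ℕ → Expr) (p : Prog) (ξ ζ η : ℕ → ℕ) :
    (ψ.specAt α γ p).ren ξ ζ η =
      ψ.specAt (fun i => (α i).ren ξ) (fun i => (γ i).ren ξ ζ η) (p.ren ξ ζ) := by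
  rw [Form.specAt, Spec.ren_subst, Form.spec_subst]
  rfl

theorem Term.exprAt_compr (s : Srt) (ψ : Form) (α : ℕ → Ty) (γ : ℕ → Expr) :
    (Term.compr s ψ).exprAt α γ =
      .tlam s.kind (.compr (ψ.ty.subst (liftTy α)) (s.index (.var 0))
        (ψ.specAt (liftTy α) (liftExpr (fun n => (γ n).ren Nat.succ Nat.succ id)) (.var 0))) := by
  simp [Term.exprAt, Term.expr, Expr.subst, Form.spec_subst, Srt.index_subst, Ty.subst,
    Prog.subst, Expr.ren_ren]
  exact ⟨rfl, rfl⟩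

theorem Term.exprAt_comprBase (ψ : Form) (α : ℕ → Ty) (γ : ℕ → Expr) :
    (Term.comprBase ψ).exprAt α γ =
      .comprBase (ψ.ty.subst α) (ψ.specAt α (fun n => (γ n).ren id Nat.succ id) (.var 0)) := by
  simp [Term.exprAt, Term.expr, Expr.subst, Form.spec_subst, Prog.subst]
  rfl

theorem Form.specAt_memBase (t : Term) (α : ℕ → Ty) (γ : ℕ → Expr) (p : Prog) :
    (Form.memBase t).specAt α γ p = .memBase p (t.exprAt α γ) := by
  simp [Form.specAt, Form.spec, Spec.subst, Prog.subst, Term.expr_subst, scons]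

theorem Form.specAt_mem (t₁ t₂ : Term) (α : ℕ → Ty) (γ : ℕ → Expr) (p : Prog) :
    (Form.mem t₁ t₂).specAt α γ p =
      .mem p (.tapp (t₂.exprAt α γ) (t₁.ty.subst α)) (t₁.exprAt α γ) := by
  simp [Form.specAt, Form.spec, Spec.subst, Expr.subst, Prog.subst, Term.expr_subst, scons]

/-- Under the second program binder, `γ` is shifted twice. -/
theorem Form.specAt_imp (ψ₁ ψ₂ : Form) (α : ℕ → Ty) (γ : ℕ → Expr) (p : Prog) :
    (Form.imp ψ₁ ψ₂).specAt α γ p =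
      .allProg (ψ₁.ty.subst α)
        (.imp (ψ₁.specAt α (fun n => (γ n).ren id Nat.succ id) (.var 0))
          (.after (.app (p.ren id Nat.succ) (.var 0))
            (ψ₂.specAt α (fun n => (γ n).ren id (fun i => i + 2) id) (.var 0)))) := by
  rw [Form.specAt]
  simp [Form.spec, Spec.subst, Form.spec_subst, Prog.subst, Expr.ren_ren, Prog.ren]
  exact ⟨rfl, ⟨rfl, rfl⟩, rfl⟩

theorem Form.specAt_all (s : Srt) (ψ : Form) (α : ℕ → Ty) (γ : ℕ → Expr) (p : Prog) :
    (Form.all s ψ).specAt α γ p =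
      .allTy s.kind (.allExpr (s.index (.var 0))
        (.after (.tapp (p.ren Nat.succ id) (.var 0))
          (ψ.specAt (liftTy α) (liftExpr (fun n => (γ n).ren Nat.succ Nat.succ id))
            (.var 0)))) := by
  rw [Form.specAt]
  simp [Form.spec, Spec.subst, Form.spec_subst, Prog.subst, Expr.ren_ren, Prog.ren,
    Srt.index_subst, Ty.subst, liftExpr_ren_id]
  exact ⟨rfl, ⟨rfl, rfl⟩, rfl⟩

/-! ### The translation commutes with substitution -/

mutual
theorem Term.ty_ren (t : Term) (ξ : ℕ → ℕ) : (t.ren ξ).ty = t.ty.ren ξ := by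
  cases t <;> simp [Term.ren, Term.ty, Ty.ren, Form.ty_ren]
theorem Form.ty_ren (ψ : Form) (ξ : ℕ → ℕ) : (ψ.ren ξ).ty = ψ.ty.ren ξ := by
  cases ψ <;> simp [Form.ren, Form.ty, Ty.ren, Form.ty_ren, Term.ty_ren]
end

theorem liftSub_ty (θ : ℕ → Term) :
    (fun i => (liftSub θ i).ty) = liftTy (fun i => (θ i).ty) := by
  funext n
  cases n with
  | zero => rfl
  | succ n => exact (θ n).ty_ren _

mutual
theorem Term.ty_subst (t : Term) (θ : ℕ → Term) :
    (t.subst θ).ty = t.ty.subst (fun i => (θ i).ty) := by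
  cases t <;> simp [Term.subst, Term.ty, Ty.subst, Form.ty_subst, liftSub_ty]
theorem Form.ty_subst (ψ : Form) (θ : ℕ → Term) :
    (ψ.subst θ).ty = ψ.ty.subst (fun i => (θ i).ty) := by
  cases ψ <;> simp [Form.subst, Form.ty, Ty.subst, Form.ty_subst, Term.ty_subst, liftSub_ty]
end

mutual
theorem Term.ren_exprAt (t : Term) (ξ : ℕ → ℕ) (α : ℕ → Ty) (γ : ℕ → Expr) :
    (t.ren ξ).exprAt α γ = t.exprAt (fun i => α (ξ i)) (fun i => γ (ξ i)) := by
  cases t with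
  | var i => rfl
  | compr s ψ =>
    simp [Term.ren, Term.exprAt_compr, Form.ty_ren, Form.ren_specAt, Ty.subst_ren,
      liftTy_comp_liftRen, liftExpr_comp_liftRen]
  | comprBase ψ =>
    simp [Term.ren, Term.exprAt_comprBase, Form.ty_ren, Form.ren_specAt, Ty.subst_ren]
theorem Form.ren_specAt (ψ : Form) (ξ : ℕ → ℕ) (α : ℕ → Ty) (γ : ℕ → Expr) (p : Prog) :
    (ψ.ren ξ).specAt α γ p = ψ.specAt (fun i => α (ξ i)) (fun i => γ (ξ i)) p := by
  cases ψ <;> simp [Form.ren, Form.specAt_memBase, Form.specAt_mem, Form.specAt_imp,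
    Form.specAt_all, Term.ren_exprAt, Form.ren_specAt, Form.ty_ren, Term.ty_ren, Ty.subst_ren,
    liftTy_comp_liftRen, liftExpr_comp_liftRen]
end

theorem liftSub_ty_subst (θ : ℕ → Term) (α : ℕ → Ty) :
    (fun i => (liftSub θ i).ty.subst (liftTy α)) = liftTy (fun i => (θ i).ty.subst α) := by
  rw [← liftTy_subst, ← liftSub_ty]

theorem liftSub_exprAt (θ : ℕ → Term) (α : ℕ → Ty) (γ : ℕ → Expr) (ζ : ℕ → ℕ) :
    (fun i => (liftSub θ i).exprAt (liftTy α)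
      (liftExpr (fun n => (γ n).ren Nat.succ ζ id))) =
    liftExpr (fun i => ((θ i).exprAt α γ).ren Nat.succ ζ id) := by
  funext n
  cases n with
  | zero => rfl
  | succ n =>
    simp only [liftSub, liftExpr, scons, Term.ren_exprAt, Term.exprAt_ren, Expr.ren_ren, Ty.ren_id]
    rfl

mutual
theorem Term.subst_exprAt (t : Term) (θ : ℕ → Term) (α : ℕ → Ty) (γ : ℕ → Expr) :
    (t.subst θ).exprAt α γ =
      t.exprAt (fun i => (θ i).ty.subst α) (fun i => (θ i).exprAt α γ) := by
  cases t with
  | var i => rfl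
  | compr s ψ =>
    simp [Term.subst, Term.exprAt_compr, Form.ty_subst, Form.subst_specAt, Ty.subst_subst,
      liftSub_ty_subst, liftSub_exprAt]
  | comprBase ψ =>
    simp [Term.subst, Term.exprAt_comprBase, Form.ty_subst, Form.subst_specAt, Ty.subst_subst,
      Term.exprAt_ren, Ty.ren_id]
theorem Form.subst_specAt (ψ : Form) (θ : ℕ → Term) (α : ℕ → Ty) (γ : ℕ → Expr) (p : Prog) :
    (ψ.subst θ).specAt α γ p =
      ψ.specAt (fun i => (θ i).ty.subst α) (fun i => (θ i).exprAt α γ) p := by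
  cases ψ <;> simp [Form.subst, Form.specAt_memBase, Form.specAt_mem, Form.specAt_imp,
    Form.specAt_all, Term.subst_exprAt, Form.subst_specAt, Form.ty_subst, Term.ty_subst,
    Ty.subst_subst, liftSub_ty_subst, liftSub_exprAt, Term.exprAt_ren, Ty.ren_id]
end

theorem Form.inst_ty_subst (ψ : Form) (t : Term) (α : ℕ → Ty) :
    (ψ.inst t).ty.subst α = ψ.ty.subst (scons (t.ty.subst α) α) := by
  rw [Form.inst, Form.ty_subst, Ty.subst_subst]
  congr 1; funext n; cases n <;> rfl

theorem Form.inst_specAt (ψ : Form) (t : Term) (α : ℕ → Ty) (γ : ℕ → Expr) (p : Prog) :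
    (ψ.inst t).specAt α γ p =
      ψ.specAt (scons (t.ty.subst α) α) (scons (t.exprAt α γ) γ) p := by
  rw [Form.inst, Form.subst_specAt]
  congr 1 <;> (funext n; cases n <;> rfl)

/-! ### The translation is well typed -/

/-- `α` interprets every variable of `S` by a type of the kind that translates its sort. -/
def TyEnv (S : List Srt) (K : List Kind) (α : ℕ → Ty) : Prop :=
  ∀ i s, S[i]? = some s → HasKind K (α i) s.kind

/-- `γ` interprets every variable of `S` by an expression whose index translates its sort,
relative to the interpretation `α` of the variables by types. -/
def ExprEnv (S : List Srt) (K : List Kind) (I : List Index) (T : List Ty) (α : ℕ → Ty)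
    (γ : ℕ → Expr) : Prop :=
  ∀ i s, S[i]? = some s → HasIndex K I T (γ i) (s.index (α i))

theorem TyEnv.lift {S : List Srt} {K : List Kind} {α : ℕ → Ty} (h : TyEnv S K α) (s : Srt) :
    TyEnv (s :: S) (s.kind :: K) (liftTy α)
  | 0, _, e => by cases e; exact .var rfl
  | i + 1, s', e => (h i s' e).ren (.succ _ _)

theorem ExprEnv.underProg {S : List Srt} {K : List Kind} {I : List Index} {T : List Ty}
    {α : ℕ → Ty} {γ : ℕ → Expr} (h : ExprEnv S K I T α γ) (τ : Ty) :
    ExprEnv S K I (τ :: T) α (fun n => (γ n).ren id Nat.succ id) := by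
  intro i s e
  have := (h i s e).ren (.refl _) (.refl _) (.succ T τ)
  rwa [Index.ren_id] at this

theorem ExprEnv.lift {S : List Srt} {K : List Kind} {I : List Index} {T : List Ty}
    {α : ℕ → Ty} {γ : ℕ → Expr} (h : ExprEnv S K I T α γ) (s : Srt) :
    ExprEnv (s :: S) (s.kind :: K) (s.index (.var 0) :: shiftIndices I) (shiftTys T) (liftTy α)
      (liftExpr (fun n => (γ n).ren Nat.succ id id))
  | 0, _, e => by cases e; exact .var rfl
  | i + 1, s', e => by
    have := (h i s' e).ren (.succ _ s.kind) (.shiftIndices I) (.shiftTys T)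
    rw [Srt.index_ren] at this
    have := this.ren (.refl _) (.succ _ (s.index (.var 0))) (.refl _)
    rwa [Index.ren_id] at this

theorem ExprEnv.liftUnderProg {S : List Srt} {K : List Kind} {I : List Index} {T : List Ty}
    {α : ℕ → Ty} {γ : ℕ → Expr} (h : ExprEnv S K I T α γ) (s : Srt) (τ : Ty) :
    ExprEnv (s :: S) (s.kind :: K) (s.index (.var 0) :: shiftIndices I) (τ :: shiftTys T)
      (liftTy α) (liftExpr (fun n => (γ n).ren Nat.succ Nat.succ id)) := by
  have := (h.lift s).underProg τ
  rw [liftExpr_ren_id] at this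
  simp only [Expr.ren_ren] at this
  exact this

theorem Srt.isIndex (s : Srt) : ∀ {K : List Kind} {τ : Ty}, HasKind K τ s.kind →
    IsIndex K (s.index τ) := by
  induction s with
  | star => exact fun h => .refBase h
  | pred s ih =>
    exact fun h => .all (.ref (.app (.var rfl) (h.ren (.succ _ _))) (ih (.var rfl)))

mutual
theorem HasSort.hasKind {S : List Srt} {t : Term} {s : Srt} (h : HasSort S t s)
    {K : List Kind} {α : ℕ → Ty} (hα : TyEnv S K α) : HasKind K (t.ty.subst α) s.kind := by
  match h with
  | .var e => exact hα _ _ e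
  | .compr h => exact .lam (IsForm.hasKind h (hα.lift _))
  | .comprBase h => exact IsForm.hasKind h hα
theorem IsForm.hasKind {S : List Srt} {ψ : Form} (h : IsForm S ψ)
    {K : List Kind} {α : ℕ → Ty} (hα : TyEnv S K α) : HasKind K (ψ.ty.subst α) .star := by
  match h with
  | .memBase h => exact HasSort.hasKind h hα
  | .mem h h' => exact .app (HasSort.hasKind h hα) (HasSort.hasKind h' hα)
  | .imp h h' => exact .arr (IsForm.hasKind h hα) (.comp (IsForm.hasKind h' hα))
  | .all h => exact .all (.comp (IsForm.hasKind h (hα.lift _)))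
end

mutual
/-- For a comprehension, the type argument of the index has to be expanded from `ψ.ty` to
`(λ X, ψ.ty) X` by conversion. -/
theorem HasSort.hasIndex {S : List Srt} {t : Term} {s : Srt} (h : HasSort S t s)
    {K : List Kind} {I : List Index} {T : List Ty} {α : ℕ → Ty} {γ : ℕ → Expr}
    (hα : TyEnv S K α) (hγ : ExprEnv S K I T α γ) :
    HasIndex K I T (t.exprAt α γ) (s.index (t.ty.subst α)) := by
  match h with
  | .var e => exact hγ _ _ e
  | .compr (s := s) (ψ := ψ) h =>
    rw [Term.exprAt_compr]
    have hψ := h.hasKind (hα.lift _)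
    refine .conv (.tlam (.compr hψ (s.isIndex (.var rfl))
      (IsForm.isSpec h (hα.lift _) ?_ (.var rfl))))
      (Srt.isIndex (.pred s) (HasSort.hasKind (.compr h) hα)) ?_
    · exact hγ.liftUnderProg s _
    · refine .all (.ref (.symm ?_) (.refl _))
      have := Ty.Conv.beta s.kind ((ψ.ty.subst (liftTy α)).ren (liftRen Nat.succ)) (.var 0)
      rwa [liftRen_inst_var] at this
  | .comprBase h =>
    rw [Term.exprAt_comprBase]
    exact .comprBase (h.hasKind hα) (IsForm.isSpec h hα (hγ.underProg _) (.var rfl))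
theorem IsForm.isSpec {S : List Srt} {ψ : Form} (h : IsForm S ψ)
    {K : List Kind} {I : List Index} {T : List Ty} {α : ℕ → Ty} {γ : ℕ → Expr} {p : Prog}
    (hα : TyEnv S K α) (hγ : ExprEnv S K I T α γ) (hp : HasType K T p (ψ.ty.subst α)) :
    IsSpec K I T (ψ.specAt α γ p) := by
  match h with
  | .memBase h =>
    rw [Form.specAt_memBase]
    exact .memBase hp (HasSort.hasIndex h hα hγ)
  | .mem (s := s) (t₁ := t₁) (t₂ := t₂) h h' =>
    rw [Form.specAt_mem]
    have := HasIndex.tapp (HasSort.hasIndex h' hα hγ) (h.hasKind hα)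
    refine .mem hp (HasSort.hasIndex h hα hγ) ?_
    simp only [Index.inst, Index.subst, Ty.subst, Ty.subst_ren, Srt.index_subst] at this
    simp only [scons, Ty.subst_var] at this
    exact this
  | .imp (ψ₁ := ψ₁) (ψ₂ := ψ₂) h h' =>
    rw [Form.specAt_imp]
    refine .allProg (h.hasKind hα) (.imp (IsForm.isSpec h hα (hγ.underProg _) (.var rfl))
      (.after (.app (hp.weakenProg _) (.var rfl)) (IsForm.isSpec h' hα ?_ (.var rfl))))
    have := (hγ.underProg (ψ₁.ty.subst α)).underProg (ψ₂.ty.subst α)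
    simp only [Expr.ren_ren] at this
    exact this
  | .all (s := s) (ψ := ψ) h =>
    rw [Form.specAt_all]
    refine .allTy (.allExpr (s.isIndex (.var rfl)) (.after
      (τ := (ψ.ty.subst (liftTy α))) ?_ (IsForm.isSpec h (hα.lift _) ?_ (.var rfl))))
    · have := HasType.tapp (hp.ren (.succ _ s.kind) (.shiftTys T)) (.var (i := 0) rfl)
      have e := liftRen_inst_var (.comp (ψ.ty.subst (liftTy α)))
      exact e ▸ this
    · exact hγ.liftUnderProg s _
end

/-! ### Typing of realizers -/

/-- `β` interprets every hypothesis in `Ψ` by a program of the type of its realizers. -/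
def ProgEnv (Ψ : List Form) (K : List Kind) (T : List Ty) (α : ℕ → Ty) (β : ℕ → Prog) : Prop :=
  ∀ i ψ, Ψ[i]? = some ψ → HasType K T (β i) (ψ.ty.subst α)

theorem ProgEnv.underProg {Ψ : List Form} {K : List Kind} {T : List Ty} {α : ℕ → Ty}
    {β : ℕ → Prog} (h : ProgEnv Ψ K T α β) (τ : Ty) :
    ProgEnv Ψ K (τ :: T) α (fun i => (β i).ren id Nat.succ) :=
  fun i ψ e => (h i ψ e).weakenProg τ

theorem ProgEnv.push {Ψ : List Form} {K : List Kind} {T : List Ty} {α : ℕ → Ty}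
    {β : ℕ → Prog} (h : ProgEnv Ψ K T α β) (ψ : Form) :
    ProgEnv (ψ :: Ψ) K (ψ.ty.subst α :: T) α (liftProg β)
  | 0, _, e => by cases e; exact .var rfl
  | i + 1, χ, e => h.underProg _ i χ e

theorem ProgEnv.lift {Ψ : List Form} {K : List Kind} {T : List Ty} {α : ℕ → Ty}
    {β : ℕ → Prog} (h : ProgEnv Ψ K T α β) (κ : Kind) :
    ProgEnv (Ψ.map (fun χ => χ.ren Nat.succ)) (κ :: K) (shiftTys T) (liftTy α)
      (fun i => (β i).ren Nat.succ id) := by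
  intro i ψ e
  simp only [List.getElem?_map, Option.map_eq_some_iff] at e
  obtain ⟨χ, e, rfl⟩ := e
  have := (h i χ e).ren (.succ K κ) (.shiftTys T)
  rw [Ty.ren_subst] at this
  rw [Form.ty_ren, Ty.subst_ren]
  exact this

/-- The types of realizers of `t ∈ {u : s | ψ}` and of `ψ[u := t]` are convertible. -/
theorem conv_mem_compr (s : Srt) (ψ : Form) (t : Term) (α : ℕ → Ty) :
    Ty.Conv ((Form.mem t (.compr s ψ)).ty.subst α) ((ψ.inst t).ty.subst α) := by
  rw [Form.inst_ty_subst, ← Ty.subst_liftTy_inst]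
  exact .beta ..

/-- The extracted program is well typed in every interpretation of the sort context and the
hypotheses. -/
theorem Derivation.hasType {S : List Srt} {Ψ : List Form} {ψ : Form} (d : Derivation S Ψ ψ) :
    ∀ {K : List Kind} {T : List Ty} {α : ℕ → Ty} {β : ℕ → Prog}, TyEnv S K α →
      ProgEnv Ψ K T α β → HasType K T (d.realizer.subst α β) (.comp (ψ.ty.subst α)) := by
  induction d with
  | ax i _ e => exact fun _ hβ => .ret (hβ _ _ e)
  | impI d ih =>
    intro K T α β hα hβ
    exact .ret (.lam ((d.isForm.1 _ (.head _)).hasKind hα) (ih hα (hβ.push _)))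
  | impE d₀ d₁ ih₀ ih₁ =>
    intro K T α β hα hβ
    refine .bind (ih₀ hα hβ) (.bind ?_ (.app (.var rfl) (.var rfl)))
    rw [Prog.ren_subst_liftProg]
    exact ih₁ hα (hβ.underProg _)
  | uniI d ih =>
    intro K T α β hα hβ
    exact .ret (.tlam (ih (hα.lift _) (hβ.lift _)))
  | uniE t d ht ih =>
    intro K T α β hα hβ
    rw [Form.inst_ty_subst, ← Ty.subst_liftTy_inst]
    exact .bind (ih hα hβ) (.tapp (τ₂ := .comp _) (.var rfl) (ht.hasKind hα))
  | memI d ht h ih =>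
    intro K T α β hα hβ
    exact .conv (ih hα hβ) (.comp ((IsForm.mem ht (.compr h)).hasKind hα))
      (.comp (.symm (conv_mem_compr ..)))
  | memE d ih =>
    intro K T α β hα hβ
    exact .conv (ih hα hβ) (.comp ((Derivation.memE d).isForm.2.hasKind hα))
      (.comp (conv_mem_compr ..))
  | memBaseI d ih => exact ih
  | memBaseE d ih => exact ih

/-! ### Derived rules for realizability specifications -/

/-- Instantiating the result variable of a realizability specification. -/
theorem Form.specAt_instProg (ψ : Form) (α : ℕ → Ty) (γ : ℕ → Expr) (p : Prog) :
    (ψ.specAt α (fun n => (γ n).ren id Nat.succ id) (.var 0)).instProg p =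
      ψ.specAt α γ p := by
  rw [Spec.instProg, Form.specAt_subst]
  simp only [Ty.subst_var, Expr.subst_ren]
  congr 1
  funext n
  exact (γ n).subst_var

theorem derivable_after_ret {S : List Srt} {K : List Kind} {I : List Index} {T : List Ty}
    {Φ : List Spec} {α : ℕ → Ty} {γ : ℕ → Expr} {p : Prog} {ψ : Form}
    (hα : TyEnv S K α) (hγ : ExprEnv S K I T α γ) (hψ : IsForm S ψ)
    (hp : HasType K T p (ψ.ty.subst α)) (h : Derivable K I T Φ (ψ.specAt α γ p)) :
    Derivable K I T Φ (.after (.ret p)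
      (ψ.specAt α (fun n => (γ n).ren id Nat.succ id) (.var 0))) := by
  refine .modI ?_ hp (hψ.isSpec hα (hγ.underProg _) (.var rfl))
  rwa [Form.specAt_instProg]

theorem derivable_after_bind {K : List Kind} {I : List Index} {T : List Ty}
    {Φ : List Spec} {α : ℕ → Ty} {γ : ℕ → Expr} {p₁ p₂ : Prog} {ψ : Form}
    (h : Derivable K I T Φ (.after p₁ (.after p₂
      (ψ.specAt α (fun n => ((γ n).ren id Nat.succ id).ren id Nat.succ id) (.var 0))))) :
    Derivable K I T Φ (.after (.bind p₁ p₂)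
      (ψ.specAt α (fun n => (γ n).ren id Nat.succ id) (.var 0))) := by
  refine .modE ?_
  rw [Form.specAt_ren]
  simp only [Ty.ren_id, Expr.ren_ren] at h ⊢
  exact h

/-- Anti-reduction below the modality: the reduct is replaced by a variable, so that the rule for
arbitrary specifications applies. -/
theorem derivable_after_red {K : List Kind} {I : List Index} {T : List Ty} {Φ : List Spec}
    {τ : Ty} {φ : Spec} {p₁ p₂ : Prog} (h : Derivable K I T Φ (.after p₂ φ))
    (hp : HasType K T p₁ (.comp τ)) (hφ : IsSpec K I (τ :: T) φ) (r : Prog.Red p₁ p₂) :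
    Derivable K I T Φ (.after p₁ φ) := by
  have e : ∀ p : Prog, (Spec.after (.var 0) (φ.ren id (liftRen Nat.succ) id)).instProg p =
      .after p φ := by
    intro p
    simp only [Spec.instProg, Spec.subst, Prog.subst, Spec.subst_ren, scons]
    congr 1
    refine Eq.trans ?_ φ.subst_var
    congr 1
    funext n; cases n <;> rfl
  rw [← e] at h ⊢
  refine .red h hp (.after (.var rfl) (hφ.ren (.refl _) (.refl _) ?_)) r
  have := (TyRen.succ T (.comp τ)).lift τ
  rwa [Ty.ren_id] at this

/-- A realizer of `ψ₁ ⊃ ψ₂` applied to a realizer of `ψ₁` computes a realizer of `ψ₂`. -/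
theorem derivable_imp_elim {K : List Kind} {I : List Index} {T : List Ty} {Φ : List Spec}
    {α : ℕ → Ty} {γ : ℕ → Expr} {p q : Prog} {ψ₁ ψ₂ : Form}
    (h : Derivable K I T Φ ((Form.imp ψ₁ ψ₂).specAt α γ p))
    (hq : HasType K T q (ψ₁.ty.subst α)) (h' : Derivable K I T Φ (ψ₁.specAt α γ q)) :
    Derivable K I T Φ (.after (.app p q)
      (ψ₂.specAt α (fun n => (γ n).ren id Nat.succ id) (.var 0))) := by
  rw [Form.specAt_imp] at h
  have := Derivable.uniProgE h hq
  have e : Prog.subst (p.ren id Nat.succ) Ty.var (scons q Prog.var) = p := by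
    rw [Prog.subst_ren]; exact p.subst_var
  rw [Spec.instProg, Spec.subst, ← Spec.instProg, Form.specAt_instProg] at this
  have := Derivable.impE this h'
  simp only [Spec.subst, Prog.subst, e, Form.specAt_subst, Ty.subst_var, Expr.subst_ren,
    Expr.ren] at this
  simp only [Expr.ren_eq_subst]
  exact this

theorem tyEnv_scons {S : List Srt} {K : List Kind} {α : ℕ → Ty} {τ : Ty} {s : Srt}
    (hα : TyEnv S K α) (h : HasKind K τ s.kind) : TyEnv (s :: S) K (scons τ α)
  | 0, _, e => by cases e; exact h
  | i + 1, s', e => hα i s' e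

/-- A realizer of `∀ u : s, ψ` applied to the type of `t` computes a realizer of `ψ[u := t]`; the
expression variable of `u` is instantiated by the expression of `t`. -/
theorem derivable_all_elim {S : List Srt} {K : List Kind} {I : List Index} {T : List Ty}
    {Φ : List Spec} {α : ℕ → Ty} {γ : ℕ → Expr} {p : Prog} {s : Srt} {ψ : Form} {t : Term}
    (hα : TyEnv S K α) (hγ : ExprEnv S K I T α γ) (ht : HasSort S t s)
    (h : Derivable K I T Φ ((Form.all s ψ).specAt α γ p)) :
    Derivable K I T Φ (.after (.tapp p (t.ty.subst α))
      ((ψ.inst t).specAt α (fun n => (γ n).ren id Nat.succ id) (.var 0))) := by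
  rw [Form.specAt_all] at h
  have := Derivable.uniTyE h (ht.hasKind hα)
  simp only [Spec.instTy, Spec.subst, Srt.index_subst] at this
  have := Derivable.uniExprE this (ht.hasIndex hα hγ)
  have e : Prog.subst (p.ren Nat.succ id) (scons (t.ty.subst α) Ty.var) Prog.var = p := by
    rw [Prog.subst_ren]; exact p.subst_var
  simp only [Spec.instExpr, Spec.subst, Form.specAt_subst, Ty.subst_var, Prog.subst, e] at this
  rw [Form.inst_specAt]
  convert this using 1
  congr 1
  · rw [Prog.subst_var]; rfl
  · congr 1
    · funext n
      cases n with
      | zero => rfl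
      | succ n =>
        simp only [liftTy_succ, Ty.subst_ren, scons]; exact (Ty.subst_var _).symm
    · funext n
      cases n with
      | zero =>
        simp [liftExpr, scons, Expr.subst, Expr.ren, Term.exprAt_ren, Ty.ren_id]
      | succ n =>
        simp only [liftExpr_succ, scons, Expr.ren_eq_subst, Expr.subst_subst]
        rfl

/-- The comprehension that translates `{u : s | ψ}` when `u` is interpreted by the type `τ`. -/
def comprAt (s : Srt) (ψ : Form) (α : ℕ → Ty) (γ : ℕ → Expr) (τ : Ty) : Expr :=
  .compr (ψ.ty.subst (scons τ α)) (s.index τ)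
    (ψ.specAt (scons τ α) (liftExpr (fun n => (γ n).ren id Nat.succ id)) (.var 0))

theorem conv_tapp_compr (s : Srt) (ψ : Form) (α : ℕ → Ty) (γ : ℕ → Expr) (τ : Ty) :
    Expr.Conv (.tapp ((Term.compr s ψ).exprAt α γ) τ) (comprAt s ψ α γ τ) := by
  have : comprAt s ψ α γ τ =
      (Expr.compr (ψ.ty.subst (liftTy α)) (s.index (.var 0)) (ψ.specAt (liftTy α)
        (liftExpr (fun n => (γ n).ren Nat.succ Nat.succ id)) (.var 0))).instTy τ := by
    simp only [Expr.instTy, Expr.subst, Srt.index_subst, Form.specAt_subst, comprAt]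
    have e : (fun i => (liftTy α i).subst (scons τ Ty.var)) = scons τ α := by
      funext n
      cases n with
      | zero => rfl
      | succ n => simp only [liftTy_succ, Ty.subst_ren, scons]; exact Ty.subst_var _
    rw [← Ty.inst, Ty.subst_liftTy_inst, e]
    congr 2
    funext n
    cases n with
    | zero => rfl
    | succ n =>
      simp only [liftExpr_succ, Expr.ren_eq_subst, Expr.subst_subst]
      rfl
  rw [this, Term.exprAt_compr]
  exact .beta ..

/-- Instantiating the comprehension `comprAt` at a program and at the expression of `t` gives the
specification of `ψ[u := t]`. -/
theorem comprAt_inst (ψ : Form) (t : Term) (α : ℕ → Ty) (γ : ℕ → Expr) (p : Prog) :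
    ((ψ.specAt (scons (t.ty.subst α) α) (liftExpr (fun n => (γ n).ren id Nat.succ id))
      (.var 0)).instProg p).instExpr (t.exprAt α γ) = (ψ.inst t).specAt α γ p := by
  rw [Form.inst_specAt, Spec.instProg, Spec.instExpr, Form.specAt_subst, Form.specAt_subst]
  simp only [Ty.subst_var]
  congr 1
  · funext n
    cases n with
    | zero => rfl
    | succ n =>
      simp only [liftExpr_succ, Expr.ren_eq_subst, Expr.subst_subst]
      exact Expr.subst_var _
  · exact p.subst_var

theorem hasIndex_comprAt {S : List Srt} {K : List Kind} {I : List Index} {T : List Ty}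
    {α : ℕ → Ty} {γ : ℕ → Expr} {τ : Ty} {s : Srt} {ψ : Form}
    (hα : TyEnv S K α) (hγ : ExprEnv S K I T α γ) (hψ : IsForm (s :: S) ψ)
    (hτ : HasKind K τ s.kind) :
    HasIndex K I T (comprAt s ψ α γ τ) (.ref (ψ.ty.subst (scons τ α)) (s.index τ)) := by
  have hα' := tyEnv_scons hα hτ
  refine .compr (hψ.hasKind hα') (s.isIndex hτ) (hψ.isSpec hα' ?_ (.var rfl))
  rintro (_ | i) s' e
  · cases e; exact .var rfl
  · have := ((hγ.underProg (ψ.ty.subst (scons τ α))) i s' e).ren (.refl _) (.succ I (s.index τ))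
      (.refl _)
    rwa [Index.ren_id] at this

theorem derivable_mem_intro {S : List Srt} {K : List Kind} {I : List Index} {T : List Ty}
    {Φ : List Spec} {α : ℕ → Ty} {γ : ℕ → Expr} {p : Prog} {s : Srt} {ψ : Form} {t : Term}
    (hα : TyEnv S K α) (hγ : ExprEnv S K I T α γ) (ht : HasSort S t s) (hψ : IsForm (s :: S) ψ)
    (hp : HasType K T p ((ψ.inst t).ty.subst α))
    (h : Derivable K I T Φ ((ψ.inst t).specAt α γ p)) :
    Derivable K I T Φ ((Form.mem t (.compr s ψ)).specAt α γ p) := by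
  have hm : IsForm S (.mem t (.compr s ψ)) := .mem ht (.compr hψ)
  have hi := hasIndex_comprAt hα hγ hψ (ht.hasKind hα)
  have hp' := hp
  rw [Form.inst_ty_subst] at hp'
  refine .conv (.memI ?_ hp' (ht.hasIndex hα hγ) hi) ?_ (hm.isSpec hα hγ
    (.conv hp (hm.hasKind hα) (.symm (conv_mem_compr ..))))
  · rwa [comprAt_inst]
  · rw [Form.specAt_mem]
    exact .mem (.refl _) (conv_tapp_compr ..) (.refl _)

theorem derivable_mem_elim {S : List Srt} {K : List Kind} {I : List Index} {T : List Ty}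
    {Φ : List Spec} {α : ℕ → Ty} {γ : ℕ → Expr} {p : Prog} {s : Srt} {ψ : Form} {t : Term}
    (hα : TyEnv S K α) (hγ : ExprEnv S K I T α γ) (ht : HasSort S t s) (hψ : IsForm (s :: S) ψ)
    (hp : HasType K T p ((ψ.inst t).ty.subst α))
    (h : Derivable K I T Φ ((Form.mem t (.compr s ψ)).specAt α γ p)) :
    Derivable K I T Φ ((ψ.inst t).specAt α γ p) := by
  have hi := hasIndex_comprAt hα hγ hψ (ht.hasKind hα)
  have hp' := hp
  rw [Form.inst_ty_subst] at hp'
  rw [← comprAt_inst]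
  refine .memE (τ := ψ.ty.subst (scons (t.ty.subst α) α)) (σ := s.index (t.ty.subst α))
    (.conv h ?_ (.mem hp' (ht.hasIndex hα hγ) hi))
  rw [Form.specAt_mem]
  exact .symm (.mem (.refl _) (conv_tapp_compr ..) (.refl _))

theorem derivable_memBase_intro {S : List Srt} {K : List Kind} {I : List Index} {T : List Ty}
    {Φ : List Spec} {α : ℕ → Ty} {γ : ℕ → Expr} {p : Prog} {ψ : Form}
    (hα : TyEnv S K α) (hγ : ExprEnv S K I T α γ) (hψ : IsForm S ψ)
    (hp : HasType K T p (ψ.ty.subst α)) (h : Derivable K I T Φ (ψ.specAt α γ p)) :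
    Derivable K I T Φ ((Form.memBase (.comprBase ψ)).specAt α γ p) := by
  have hi := (HasSort.comprBase hψ).hasIndex hα hγ
  rw [Form.specAt_memBase]
  rw [Term.exprAt_comprBase] at hi ⊢
  refine .memBaseI ?_ hp hi
  rwa [Form.specAt_instProg]

theorem derivable_memBase_elim {K : List Kind} {I : List Index} {T : List Ty}
    {Φ : List Spec} {α : ℕ → Ty} {γ : ℕ → Expr} {p : Prog} {ψ : Form}
    (h : Derivable K I T Φ ((Form.memBase (.comprBase ψ)).specAt α γ p)) :
    Derivable K I T Φ (ψ.specAt α γ p) := by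
  rw [Form.specAt_memBase, Term.exprAt_comprBase] at h
  have := Derivable.memBaseE h
  rwa [Form.specAt_instProg] at this

/-! ### Soundness -/

/-- An interpretation of the sort context `S` and the hypotheses `Ψ` in the well-formed contexts
`K | I | T | Φ` of the target logic: the variables of `S` are interpreted by the types `α` and the
expressions `γ`, and every hypothesis by a program `β i` which, according to `Φ`, realizes it. -/
structure Interpretation (S : List Srt) (Ψ : List Form) (K : List Kind) (I : List Index)
    (T : List Ty) (Φ : List Spec) (α : ℕ → Ty) (β : ℕ → Prog) (γ : ℕ → Expr) : Prop where
  isIndex : ∀ σ ∈ I, IsIndex K σ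
  hasKind : ∀ τ ∈ T, HasKind K τ .star
  isSpec : ∀ φ ∈ Φ, IsSpec K I T φ
  ty : TyEnv S K α
  expr : ExprEnv S K I T α γ
  prog : ProgEnv Ψ K T α β
  spec : ∀ (i : ℕ) (ψ : Form), Ψ[i]? = some ψ → ψ.specAt α γ (β i) ∈ Φ

namespace Interpretation

variable {S : List Srt} {Ψ : List Form} {K : List Kind} {I : List Index} {T : List Ty}
  {Φ : List Spec} {α : ℕ → Ty} {β : ℕ → Prog} {γ : ℕ → Expr}

theorem derivable (v : Interpretation S Ψ K I T Φ α β γ) {i : ℕ} {ψ : Form} (e : Ψ[i]? = some ψ) :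
    Derivable K I T Φ (ψ.specAt α γ (β i)) :=
  .ax v.isIndex v.hasKind v.isSpec (v.spec i ψ e)

theorem tail {ψ : Form} (v : Interpretation S (ψ :: Ψ) K I T Φ α β γ) :
    Interpretation S Ψ K I T Φ α (fun i => β (i + 1)) γ :=
  { v with
    prog := fun i => v.prog (i + 1)
    spec := fun i => v.spec (i + 1) }

/-- The extension by a hypothesis, interpreted by a new program variable. -/
theorem push (v : Interpretation S Ψ K I T Φ α β γ) {ψ : Form} (hψ : IsForm S ψ) :
    Interpretation S (ψ :: Ψ) K I (ψ.ty.subst α :: T)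
      (ψ.specAt α (fun n => (γ n).ren id Nat.succ id) (.var 0) ::
        Φ.map (fun χ => χ.ren id Nat.succ id))
      α (liftProg β) (fun n => (γ n).ren id Nat.succ id) where
  isIndex := v.isIndex
  hasKind := List.forall_mem_cons.2 ⟨hψ.hasKind v.ty, v.hasKind⟩
  isSpec := by
    refine List.forall_mem_cons.2 ⟨hψ.isSpec v.ty (v.expr.underProg _) (.var rfl), ?_⟩
    refine List.forall_mem_map.2 fun φ hφ => ?_
    exact (v.isSpec φ hφ).ren (.refl _) (.refl _) (.succ _ _)
  ty := v.ty
  expr := v.expr.underProg _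
  prog := v.prog.push ψ
  spec := by
    rintro (_ | i) χ e
    · cases e; exact .head _
    · have := List.mem_map_of_mem (f := fun χ : Spec => χ.ren id Nat.succ id) (v.spec i χ e)
      simp only [Form.specAt_ren, Ty.ren_id] at this
      exact .tail _ this

/-- The extension by a variable of higher-order logic, interpreted by a new type variable and a
new expression variable. -/
theorem lift (v : Interpretation S Ψ K I T Φ α β γ) (s : Srt) :
    Interpretation (s :: S) (Ψ.map (fun χ => χ.ren Nat.succ)) (s.kind :: K)
      (s.index (.var 0) :: shiftIndices I) (shiftTys T)
      ((Φ.map (fun χ => χ.ren Nat.succ id id)).map (fun χ => χ.ren id id Nat.succ))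
      (liftTy α) (fun i => (β i).ren Nat.succ id)
      (liftExpr (fun n => (γ n).ren Nat.succ id id)) where
  isIndex := by
    refine List.forall_mem_cons.2 ⟨s.isIndex (.var rfl), List.forall_mem_map.2 fun σ hσ => ?_⟩
    exact (v.isIndex σ hσ).ren (.succ _ _)
  hasKind := List.forall_mem_map.2 fun τ hτ => (v.hasKind τ hτ).ren (.succ _ _)
  isSpec := by
    simp only [List.map_map]
    refine List.forall_mem_map.2 fun φ hφ => ?_
    exact ((v.isSpec φ hφ).ren (.succ _ s.kind) (.shiftIndices _) (.shiftTys _)).ren (.refl _)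
      (.succ _ _) (.refl _)
  ty := v.ty.lift s
  expr := v.expr.lift s
  prog := v.prog.lift _
  spec := by
    intro i ψ e
    simp only [List.getElem?_map, Option.map_eq_some_iff] at e
    obtain ⟨χ, e, rfl⟩ := e
    have := List.mem_map_of_mem (f := fun χ : Spec => χ.ren id id Nat.succ)
      (List.mem_map_of_mem (f := fun χ : Spec => χ.ren Nat.succ id id) (v.spec i χ e))
    simp only [Form.specAt_ren, Ty.ren_id, Prog.ren_id] at this
    rw [Form.ren_specAt]
    exact this

end Interpretation

/-- Soundness in an arbitrary interpretation. -/
theorem Derivation.sound {S : List Srt} {Ψ : List Form} {ψ : Form} (d : Derivation S Ψ ψ) :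
    ∀ {K : List Kind} {I : List Index} {T : List Ty} {Φ : List Spec} {α : ℕ → Ty}
      {β : ℕ → Prog} {γ : ℕ → Expr}, Interpretation S Ψ K I T Φ α β γ →
      Derivable K I T Φ (.after (d.realizer.subst α β)
        (ψ.specAt α (fun n => (γ n).ren id Nat.succ id) (.var 0))) := by
  induction d with
  | ax i h e =>
    intro K I T Φ α β γ v
    exact derivable_after_ret v.ty v.expr (h _ (List.mem_of_getElem? e)) (v.prog _ _ e)
      (v.derivable e)
  | @impI S Ψ ψ₁ ψ₂ d ih =>
    intro K I T Φ α β γ v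
    have w := d.isForm
    have hψ₁ := w.1 _ (.head _)
    have hl : HasType K T ((Prog.lam ψ₁.ty d.realizer).subst α β)
        ((Form.imp ψ₁ ψ₂).ty.subst α) :=
      .lam (hψ₁.hasKind v.ty) (d.hasType v.ty (v.prog.push _))
    refine derivable_after_ret v.ty v.expr (.imp hψ₁ w.2) hl ?_
    rw [Form.specAt_imp]
    refine .uniProgI (.impI ?_)
    have v' := v.push hψ₁
    have := ih v'
    simp only [Expr.ren_ren] at this
    refine derivable_after_red this (.app (hl.weakenProg _) (.var rfl))
      (w.2.isSpec v'.ty ?_ (.var rfl)) ?_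
    · have := v'.expr.underProg (ψ₂.ty.subst α)
      simp only [Expr.ren_ren] at this
      exact this
    -- The bound variable is the fresh program variable, which is a value, so `β` applies.
    · have r := Prog.Red.beta ((ψ₁.ty.subst α).ren id)
        ((d.realizer.subst α (liftProg β)).ren id (liftRen Nat.succ)) _ (.var 0)
      have e : ((d.realizer.subst α (liftProg β)).ren id (liftRen Nat.succ)).inst (.var 0) =
          d.realizer.subst α (liftProg β) := by
        rw [Prog.inst, Prog.subst_ren]
        refine Eq.trans ?_ (Prog.subst_var _)
        congr 1; funext n; cases n <;> rfl
      rwa [e] at r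
  | @impE S Ψ ψ₁ ψ₂ d₀ d₁ ih₀ ih₁ =>
    intro K I T Φ α β γ v
    -- `x₀` realizes the implication; the second premise ignores it, hence `v₁.tail`.
    have v₁ := v.push d₀.isForm.2
    refine derivable_after_bind (.mon ?_ (ih₀ v) (d₀.hasType v.ty v.prog))
    have h₁ := ih₁ v₁.tail
    have t₁ := d₁.hasType v₁.ty v₁.tail.prog
    rw [← Prog.ren_subst_liftProg] at h₁ t₁
    refine derivable_after_bind (.mon ?_ h₁ t₁)
    have v₂ := v₁.push d₁.isForm.2
    exact derivable_imp_elim (v₂.derivable (i := 1) rfl) (v₂.prog 0 _ rfl)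
      (v₂.derivable (i := 0) rfl)
  | @uniI S Ψ s ψ d ih =>
    intro K I T Φ α β γ v
    have hl : HasType K T ((Prog.tlam s.kind d.realizer).subst α β)
        ((Form.all s ψ).ty.subst α) :=
      .tlam (d.hasType (v.ty.lift s) (v.prog.lift _))
    refine derivable_after_ret v.ty v.expr (.all d.isForm.2) hl ?_
    rw [Form.specAt_all]
    refine .uniTyI (.uniExprI ?_)
    have v' := v.lift s
    have := ih v'
    simp only [liftExpr_ren_id, Expr.ren_ren] at this
    refine derivable_after_red (τ := ψ.ty.subst (liftTy α)) this ?_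
      (d.isForm.2.isSpec v'.ty (v.expr.liftUnderProg s _) (.var rfl)) ?_
    · have := HasType.tapp (hl.ren (.succ _ s.kind) (.shiftTys T)) (.var (i := 0) rfl)
      have e := liftRen_inst_var (.comp (ψ.ty.subst (liftTy α)))
      exact e ▸ this
    · have r := Prog.Red.tbeta s.kind
        ((d.realizer.subst (liftTy α) (fun i => (β i).ren Nat.succ id)).ren (liftRen Nat.succ) id)
        (.var 0)
      have e : ((d.realizer.subst (liftTy α) (fun i => (β i).ren Nat.succ id)).ren
          (liftRen Nat.succ) id).instTy (.var 0) =
          d.realizer.subst (liftTy α) (fun i => (β i).ren Nat.succ id) := by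
        rw [Prog.instTy, Prog.subst_ren]
        refine Eq.trans ?_ (Prog.subst_var _)
        congr 1; funext n; cases n <;> rfl
      rwa [e] at r
  | uniE t d ht ih =>
    intro K I T Φ α β γ v
    have v₁ := v.push d.isForm.2
    refine derivable_after_bind (.mon ?_ (ih v) (d.hasType v.ty v.prog))
    exact derivable_all_elim v₁.ty v₁.expr ht (v₁.derivable (i := 0) rfl)
  | memI d ht hψ ih =>
    intro K I T Φ α β γ v
    have v₁ := v.push d.isForm.2
    refine .mon ?_ (ih v) (d.hasType v.ty v.prog)
    exact derivable_mem_intro v₁.ty v₁.expr ht hψ (v₁.prog 0 _ rfl) (v₁.derivable (i := 0) rfl)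
  | memE d ih =>
    intro K I T Φ α β γ v
    have v₁ := v.push d.isForm.2
    have w := d.isForm.2
    cases w with | mem ht hc =>
    cases hc with | compr hψ =>
    refine .mon ?_ (ih v) (d.hasType v.ty v.prog)
    refine derivable_mem_elim v₁.ty v₁.expr ht hψ ?_ (v₁.derivable (i := 0) rfl)
    exact .conv (v₁.prog 0 _ rfl) ((hψ.inst ht).hasKind v₁.ty) (conv_mem_compr ..)
  | memBaseI d ih =>
    intro K I T Φ α β γ v
    have v₁ := v.push d.isForm.2
    refine .mon ?_ (ih v) (d.hasType v.ty v.prog)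
    exact derivable_memBase_intro v₁.ty v₁.expr d.isForm.2 (v₁.prog 0 _ rfl)
      (v₁.derivable (i := 0) rfl)
  | memBaseE d ih =>
    intro K I T Φ α β γ v
    have v₁ := v.push d.isForm.2
    refine .mon ?_ (ih v) (d.hasType v.ty v.prog)
    exact derivable_memBase_elim (v₁.derivable (i := 0) rfl)

theorem getElem?_indexCtx (S : List Srt) : ∀ (i : ℕ) (s : Srt), S[i]? = some s →
    (indexCtx S)[i]? = some (s.index (.var i)) := by
  induction S with
  | nil => intro i s e; cases e
  | cons s' S ih =>
    rintro (_ | i) s e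
    · cases e; rfl
    · simp [indexCtx, shiftIndices, ih i s e, Srt.index_ren, Ty.ren]

theorem isIndex_of_mem_indexCtx (S : List Srt) : ∀ σ ∈ indexCtx S, IsIndex (kindCtx S) σ := by
  induction S with
  | nil => intro σ h; cases h
  | cons s S ih =>
    refine List.forall_mem_cons.2 ⟨s.isIndex (.var rfl), List.forall_mem_map.2 fun σ h => ?_⟩
    exact (ih σ h).ren (.succ _ _)

theorem tyEnv_var (S : List Srt) : TyEnv S (kindCtx S) Ty.var :=
  fun i s e => .var (by simp [kindCtx, e])

theorem progEnv_var (S : List Srt) (Ψ : List Form) :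
    ProgEnv Ψ (kindCtx S) (tyCtx Ψ) Ty.var Prog.var :=
  fun i ψ e => .var (by simp [tyCtx, e, Ty.subst_var])

/-- In the translated contexts, extended arbitrarily, every variable is interpreted by its own
shift past the extension. -/
theorem interpretation_append {S : List Srt} {Ψ : List Form} (hΨ : ∀ χ ∈ Ψ, IsForm S χ)
    {K : List Kind} {I : List Index} {T : List Ty} {Φ : List Spec}
    (hI : ∀ σ ∈ I, IsIndex (K ++ kindCtx S) σ) (hT : ∀ τ ∈ T, HasKind (K ++ kindCtx S) τ .star)
    (hΦ : ∀ φ ∈ Φ, IsSpec (K ++ kindCtx S)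
      (I ++ (indexCtx S).map (fun σ => σ.ren (· + K.length)))
      (T ++ (tyCtx Ψ).map (fun τ => τ.ren (· + K.length))) φ) :
    Interpretation S Ψ (K ++ kindCtx S) (I ++ (indexCtx S).map (fun σ => σ.ren (· + K.length)))
      (T ++ (tyCtx Ψ).map (fun τ => τ.ren (· + K.length)))
      ((specCtx Ψ).map (fun φ => φ.ren (· + K.length) (· + T.length) (· + I.length)) ++ Φ)
      (fun i => .var (i + K.length)) (fun i => .var (i + T.length))
      (fun i => .var (i + I.length)) := by
  have hK : KindRen (kindCtx S) (K ++ kindCtx S) (· + K.length) := by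
    intro i κ e
    rwa [List.getElem?_append_right (Nat.le_add_left ..), Nat.add_sub_cancel]
  have ty : TyEnv S (K ++ kindCtx S) (fun i => .var (i + K.length)) :=
    fun i s e => (tyEnv_var S i s e).ren hK
  have expr : ExprEnv S (K ++ kindCtx S)
      (I ++ (indexCtx S).map (fun σ => σ.ren (· + K.length)))
      (T ++ (tyCtx Ψ).map (fun τ => τ.ren (· + K.length)))
      (fun i => .var (i + K.length)) (fun i => .var (i + I.length)) := by
    intro i s e
    refine .var ?_
    rw [List.getElem?_append_right (Nat.le_add_left ..), Nat.add_sub_cancel]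
    simp [getElem?_indexCtx S i s e, Srt.index_ren, Ty.ren]
  have prog : ProgEnv Ψ (K ++ kindCtx S) (T ++ (tyCtx Ψ).map (fun τ => τ.ren (· + K.length)))
      (fun i => .var (i + K.length)) (fun i => .var (i + T.length)) := by
    intro i ψ e
    refine .var ?_
    rw [List.getElem?_append_right (Nat.le_add_left ..), Nat.add_sub_cancel]
    simp [tyCtx, e, Ty.ren_eq_subst]
  have spec : ∀ (i : ℕ) (ψ : Form), Ψ[i]? = some ψ →
      ψ.specAt (fun i => .var (i + K.length)) (fun i => .var (i + I.length))
        (.var (i + T.length)) ∈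
      (specCtx Ψ).map (fun φ => φ.ren (· + K.length) (· + T.length) (· + I.length)) := by
    intro i ψ e
    refine List.mem_map.2 ⟨ψ.spec (.var i), List.mem_of_getElem? (i := i) ?_, ?_⟩
    · simp [specCtx, e]
    · rw [Spec.ren_eq_subst, Form.spec_subst]
      rfl
  refine ⟨?_, ?_, ?_, ty, expr, prog, fun i ψ e => List.mem_append_left _ (spec i ψ e)⟩
  · refine List.forall_mem_append.2 ⟨hI, List.forall_mem_map.2 fun σ hσ => ?_⟩
    exact (isIndex_of_mem_indexCtx S σ hσ).ren hK
  · refine List.forall_mem_append.2 ⟨hT, List.forall_mem_map.2 fun τ hτ => ?_⟩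
    obtain ⟨ψ, hψ, rfl⟩ := List.mem_map.1 hτ
    rw [Ty.ren_eq_subst]
    exact (hΨ ψ hψ).hasKind ty
  · refine List.forall_mem_append.2 ⟨List.forall_mem_map.2 fun φ hφ => ?_, hΦ⟩
    obtain ⟨i, hi, rfl⟩ := List.mem_mapIdx.1 hφ
    rw [Spec.ren_eq_subst, Form.spec_subst]
    exact (hΨ _ (List.getElem_mem hi)).isSpec ty expr
      (prog i _ (List.getElem?_eq_getElem hi))

end HOL

theorem theorem1 {S : List HOL.Srt} {Ψ : List HOL.Form} {ψ : HOL.Form}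
    (d : HOL.Derivation S Ψ ψ) :
    ∃ p : EffHOL.Prog, p = d.realizer ∧
      EffHOL.HasType (HOL.kindCtx S) (HOL.tyCtx Ψ) p (.comp ψ.ty) ∧
      ∀ (K : List EffHOL.Kind) (I : List EffHOL.Index) (T : List EffHOL.Ty)
        (Φ : List EffHOL.Spec),
        (∀ σ ∈ I, EffHOL.IsIndex (K ++ HOL.kindCtx S) σ) →
        (∀ τ ∈ T, EffHOL.HasKind (K ++ HOL.kindCtx S) τ .star) →
        (∀ φ ∈ Φ, EffHOL.IsSpec
          (K ++ HOL.kindCtx S)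
          (I ++ (HOL.indexCtx S).map (fun σ => σ.ren (· + K.length)))
          (T ++ (HOL.tyCtx Ψ).map (fun τ => τ.ren (· + K.length)))
          φ) →
        EffHOL.HoareTriple
          (K ++ HOL.kindCtx S)
          (I ++ (HOL.indexCtx S).map (fun σ => σ.ren (· + K.length)))
          (T ++ (HOL.tyCtx Ψ).map (fun τ => τ.ren (· + K.length)))
          ((HOL.specCtx Ψ).map
            (fun φ => φ.ren (· + K.length) (· + T.length) (· + I.length)) ++ Φ)
          (p.ren (· + K.length) (· + T.length))
          ((ψ.spec (.var 0)).ren (· + K.length) (liftRen (· + T.length)) (· + I.length)) := by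
  refine ⟨d.realizer, rfl, ?_, fun K I T Φ hI hT hΦ => ?_⟩
  · have := d.hasType (HOL.tyEnv_var S) (HOL.progEnv_var S Ψ)
    rwa [EffHOL.Prog.subst_var, EffHOL.Ty.subst_var] at this
  · have := d.sound (HOL.interpretation_append d.isForm.1 hI hT hΦ)
    rw [EffHOL.Prog.ren_eq_subst, EffHOL.Spec.ren_eq_subst, HOL.Form.spec_subst]
    exact this
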